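/- Let $n\ge 1$. An alternating sign matrix (ASM) of order $n$ is an $n\times n$ matrix with entries in $\{0,1,-1\}$ in which the nonzero entries alternate in sign along each row and column and the entries of each row and column sum to $1$; let $\mathrm{ASM}(n)$ be the set of these. For $A\in\mathrm{ASM}(n)$ let $$\nu(A)=\sum_{\substack{1\le i<i'\le n\\ 1\le j'\le j\le n}}A_{ij}A_{i'j'}\ (\ge 0),$$ let $\mu(A)$ be the number of entries of $A$ equal to $-1$, let $\rho(A)$ be the number of $0$'s to the left of the $1$ in the first row of $A$, and set $$Z_{\mathrm{ASM}}(n,x,y,z)=\sum_{A\in\mathrm{ASM}(n)}x^{\nu(A)}y^{\mu(A)}z^{\rho(A)}.$$ **Proposition.** Let $x,y,z,\omega$ be elements of a commutative ring (for instance complex numbers) such that $y\omega^2+(1-x-y)\omega+x=0$, and let $M_{\mathrm{ASM}}(n,x,y,z)$ be the $n\times n$ matrix with entries, for $0\le i,j\le n-1$, $$M_{\mathrm{ASM}}(n,x,y,z)_{ij}=(1-\omega)\,\delta_{ij}+\omega\begin{cases}\displaystyle\sum_{k=0}^{\min(i,j)}\binom ik\binom jk x^k y^{i-k}, & j\le n-2,\\[3mm]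 \displaystyle\sum_{k=0}^{i}\sum_{l=0}^{k}\binom ik\binom{n-l-2}{k-l}x^k y^{i-k}z^{l+1}, & j=n-1,\end{cases}$$ where $\binom{-1}{0}=1$. Then $$(1+\omega(z-1))\,Z_{\mathrm{ASM}}(n,x,y,z)=\det M_{\mathrm{ASM}}(n,x,y,z).$$ -/

import Mathlib

namespace RefinedASM

/-- The nonzero entries of the finite sequence `f` alternate in sign: whenever two nonzero entries
are separated only by zeros, they have opposite signs. -/
def Alternates {n : ℕ} (f : Fin n → ℤ) : Prop :=
  ∀ j j' : Fin n, j < j' → f j ≠ 0 → f j' ≠ 0 → (∀ k, j < k → k < j' → f k = 0) →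
    Int.sign (f j') = -Int.sign (f j)

/-- Alternating sign matrices. -/
structure IsASM {n : ℕ} (A : Matrix (Fin n) (Fin n) ℤ) : Prop where
  entries : ∀ i j, A i j = 0 ∨ A i j = 1 ∨ A i j = -1
  alternates_row : ∀ i, Alternates (fun j => A i j)
  alternates_col : ∀ j, Alternates (fun i => A i j)
  sum_row : ∀ i, ∑ j, A i j = 1
  sum_col : ∀ j, ∑ i, A i j = 1

theorem finite_setOf_isASM (n : ℕ) : {A : Matrix (Fin n) (Fin n) ℤ | IsASM A}.Finite := by
  refine Set.Finite.subset
    (Set.Finite.pi' (t := fun _ : Fin n => {r : Fin n → ℤ | ∀ j, r j ∈ ({0, 1, -1} : Set ℤ)})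
      fun _ => Set.Finite.pi' fun _ => Set.toFinite _) ?_
  intro A hA i j
  simpa using hA.entries i j

/-- The finite set of all `n × n` alternating sign matrices. -/
noncomputable def asm (n : ℕ) : Finset (Matrix (Fin n) (Fin n) ℤ) :=
  (finite_setOf_isASM n).toFinset

theorem mem_asm {n : ℕ} {A : Matrix (Fin n) (Fin n) ℤ} : A ∈ asm n ↔ IsASM A := by
  simp [asm]

/-- The integer `∑ A i j * A i' j'` over all `i < i'` and `j' ≤ j`. -/
def inv {n : ℕ} (A : Matrix (Fin n) (Fin n) ℤ) : ℤ :=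
  ∑ i, ∑ i' ∈ Finset.Ioi i, ∑ j, ∑ j' ∈ Finset.Iic j, A i j * A i' j'

/-- The statistic `ν` as a natural number; for an alternating sign matrix nothing is lost in the
conversion, see `natCast_nu`. -/
def nu {n : ℕ} (A : Matrix (Fin n) (Fin n) ℤ) : ℕ := (inv A).toNat

/-- The statistic `μ`: the number of entries `-1`. -/
def mu {n : ℕ} (A : Matrix (Fin n) (Fin n) ℤ) : ℕ :=
  (Finset.univ.filter fun p : Fin n × Fin n => A p.1 p.2 = -1).card

/-- The statistic `ρ`: the number of `0`s to the left of the `1` in the first row. -/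
def rho {n : ℕ} [NeZero n] (A : Matrix (Fin n) (Fin n) ℤ) : ℕ :=
  (Finset.univ.filter fun j : Fin n => A 0 j = 0 ∧ ∃ j', j < j' ∧ A 0 j' = 1).card

/-- The generating function `Z_ASM(n, x, y, z)`. -/
noncomputable def ZASM (n : ℕ) [NeZero n] {R : Type*} [CommRing R] (x y z : R) : R :=
  ∑ A ∈ asm n, x ^ nu A * y ^ mu A * z ^ rho A

/-- The matrix `M_ASM(n, x, y, z)`, with rows and columns indexed by `0, …, n - 1`.
In the last column, the natural number subtraction in `n - l - 2` truncates only for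
`l = k = n - 1`, where the binomial coefficient `C(-1, 0) = 1` is correctly given as
`C(0, 0) = 1`. -/
def MASM (n : ℕ) {R : Type*} [CommRing R] (x y z w : R) : Matrix (Fin n) (Fin n) R :=
  Matrix.of fun i j =>
    (1 - w) * (if i = j then 1 else 0) + w *
      (if j.val + 1 = n then
        ∑ k ∈ Finset.range (i.val + 1), ∑ l ∈ Finset.range (k + 1),
          (i.val.choose k : R) * ((n - l - 2).choose (k - l) : R) *
            x ^ k * y ^ (i.val - k) * z ^ (l + 1)
      else
        ∑ k ∈ Finset.range (min i.val j.val + 1),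
          (i.val.choose k : R) * (j.val.choose k : R) * x ^ k * y ^ (i.val - k))

/-! Proof that the integer `inv A` is nonnegative for an alternating sign matrix `A`. -/

theorem sum_Ico_mem {g : ℕ → ℤ}
    (h : ∀ a b, a < b → g a ≠ 0 → g b ≠ 0 → (∀ c, a < c → c < b → g c = 0) → g b = -g a)
    (a b : ℕ) (hab : a ≤ b) :
    ((∀ c, a ≤ c → c < b → g c = 0) ∧ ∑ c ∈ Finset.Ico a b, g c = 0) ∨
    (∃ l, l < b ∧ g l ≠ 0 ∧ (∀ c, l < c → c < b → g c = 0) ∧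
      (∑ c ∈ Finset.Ico a b, g c = g l ∨ ∑ c ∈ Finset.Ico a b, g c = 0)) := by
  induction b, hab using Nat.le_induction with
  | base => left; exact ⟨fun c h1 h2 => by omega, by simp⟩
  | succ b hab ih =>
    rw [Finset.sum_Ico_succ_top hab]
    by_cases h0 : g b = 0
    · rw [h0, add_zero]
      rcases ih with ⟨h1, h2⟩ | ⟨l, hl, hl0, h1, h2⟩
      · left
        refine ⟨fun c hc hc' => ?_, h2⟩
        rcases Nat.lt_succ_iff_lt_or_eq.mp hc' with h3 | h3
        · exact h1 c hc h3
        · rw [h3, h0]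
      · right
        refine ⟨l, by omega, hl0, fun c hc hc' => ?_, h2⟩
        rcases Nat.lt_succ_iff_lt_or_eq.mp hc' with h3 | h3
        · exact h1 c hc h3
        · rw [h3, h0]
    · right
      refine ⟨b, by omega, h0, fun c hc hc' => by omega, ?_⟩
      rcases ih with ⟨h1, h2⟩ | ⟨l, hl, hl0, h1, h2⟩
      · left; rw [h2, zero_add]
      · have := h l b hl hl0 h0 h1
        rcases h2 with h2 | h2
        · right; rw [h2, this]; ring
        · left; rw [h2, zero_add]

theorem prefix_nonneg {g : ℕ → ℤ} (hg : ∀ a, g a = 0 ∨ g a = 1 ∨ g a = -1)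
    (h : ∀ a b, a < b → g a ≠ 0 → g b ≠ 0 → (∀ c, a < c → c < b → g c = 0) → g b = -g a)
    {m n : ℕ} (hmn : m ≤ n) (hs : ∑ c ∈ Finset.range n, g c = 1) :
    0 ≤ ∑ c ∈ Finset.range m, g c := by
  have key : ∑ c ∈ Finset.Ico m n, g c ≤ 1 := by
    rcases sum_Ico_mem h m n hmn with ⟨_, h2⟩ | ⟨l, _, _, _, h2⟩
    · omega
    · rcases hg l with h3 | h3 | h3 <;> rcases h2 with h2 | h2 <;> omega
  have := Finset.sum_range_add_sum_Ico g hmn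
  omega

theorem Alternates.prefix_nonneg {n : ℕ} {f : Fin n → ℤ} (hf : Alternates f)
    (he : ∀ j, f j = 0 ∨ f j = 1 ∨ f j = -1) (hs : ∑ j, f j = 1) (m : ℕ) (hm : m ≤ n) :
    0 ≤ ∑ j ∈ Finset.univ.filter (fun j : Fin n => j.val < m), f j := by
  set g : ℕ → ℤ := fun a => if ha : a < n then f ⟨a, ha⟩ else 0 with hgdef
  have hgf : ∀ j : Fin n, g j.val = f j := fun j => by simp [hgdef]
  have hg : ∀ a, g a = 0 ∨ g a = 1 ∨ g a = -1 := by
    intro a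
    by_cases ha : a < n
    · simpa [hgdef, ha] using he ⟨a, ha⟩
    · simp [hgdef, ha]
  have h : ∀ a b, a < b → g a ≠ 0 → g b ≠ 0 → (∀ c, a < c → c < b → g c = 0) → g b = -g a := by
    intro a b hab ha hb hc
    have hbn : b < n := by
      by_contra hbn
      exact hb (by simp [hgdef, hbn])
    have han : a < n := hab.trans hbn
    have ha' : g a = f ⟨a, han⟩ := hgf ⟨a, han⟩
    have hb' : g b = f ⟨b, hbn⟩ := hgf ⟨b, hbn⟩
    have := hf ⟨a, han⟩ ⟨b, hbn⟩ hab (ha' ▸ ha) (hb' ▸ hb)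
      (fun k hk hk' => by rw [← hgf k]; exact hc k hk hk')
    rw [ha', hb']
    rcases he ⟨a, han⟩ with h1 | h1 | h1 <;> rcases he ⟨b, hbn⟩ with h2 | h2 | h2 <;>
      rw [h1, h2] at this ⊢ <;> simp_all
  have hs' : ∑ c ∈ Finset.range n, g c = 1 := by
    rw [← hs, Finset.sum_range]
    exact Finset.sum_congr rfl fun j _ => hgf j
  have := RefinedASM.prefix_nonneg hg h hm hs'
  refine this.trans_eq ?_
  refine (Finset.sum_bij (fun j _ => j.val) ?_ ?_ ?_ ?_).symm
  · intro j hj; simpa using hj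
  · intro j _ j' _ hjj; exact Fin.ext hjj
  · intro c hc
    have hc' : c < m := by simpa using hc
    exact ⟨⟨c, hc'.trans_le hm⟩, by simpa using hc', rfl⟩
  · intro j _; exact (hgf j).symm

theorem IsASM.inv_nonneg {n : ℕ} {A : Matrix (Fin n) (Fin n) ℤ} (hA : IsASM A) : 0 ≤ inv A := by
  have e : inv A = ∑ i', ∑ j, (∑ i ∈ Finset.univ.filter (fun i : Fin n => i.val < i'.val), A i j) *
      (∑ j' ∈ Finset.univ.filter (fun k : Fin n => k.val < j.val + 1), A i' j') := by
    unfold inv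
    rw [Finset.sum_comm' (t' := Finset.univ)
      (s' := fun i' => Finset.univ.filter (fun i : Fin n => i.val < i'.val))
      (by intro a b; simp)]
    refine Finset.sum_congr rfl fun i' _ => ?_
    rw [Finset.sum_comm]
    refine Finset.sum_congr rfl fun j _ => ?_
    rw [Finset.sum_mul]
    refine Finset.sum_congr rfl fun i _ => ?_
    rw [Finset.mul_sum]
    refine Finset.sum_congr ?_ fun _ _ => rfl
    ext k
    simp only [Finset.mem_Iic, Finset.mem_filter, Finset.mem_univ, true_and, Fin.le_def, Nat.lt_succ_iff]
  rw [e]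
  refine Finset.sum_nonneg fun i' _ => Finset.sum_nonneg fun j _ => mul_nonneg ?_ ?_
  · exact (hA.alternates_col j).prefix_nonneg (fun i => hA.entries i j) (hA.sum_col j) _ i'.2.le
  · exact (hA.alternates_row i').prefix_nonneg (fun k => hA.entries i' k) (hA.sum_row i') _ j.2

theorem natCast_nu {n : ℕ} {A : Matrix (Fin n) (Fin n) ℤ} (hA : IsASM A) :
    (nu A : ℤ) = inv A :=
  Int.toNat_of_nonneg hA.inv_nonneg

end RefinedASM

/-! Partial column and row sums turn alternating sign matrices into six-vertex configurations with
domain wall boundary. The vertex weights carry spectral parameters `v` (rows) and `u` (columns). At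
`u = v = 0` a configuration has weight x^ν y^μ; giving the first row instead the parameter c with
z(1 - c) = 1 also produces z^ρ, after multiplication by z^(n-1) (`pow_mul_dwbc`).

For general parameters the partition function is an Izergin–Korepin determinant
(`dwbc_mul_vandermonde`), by interpolation in one column parameter: the row transfer matrices
commute by Yang–Baxter, so the partition function is symmetric in `v`, and at u_0 = 1/v_k the
lattice freezes to one of smaller size.

The equation for ω makes (1-ω)/`wtA` + ω/`wtB` equal to 1/(`wtA` `wtB`) up to a row factor and a
column factor, so the determinant may be taken with these sums as entries. They are geometric series
in u; comparing coefficients of the staircase monomial strips off the Vandermonde factor and sets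
all u to 0 (`dwbc_mul_vandermonde_zero`). The same step for all rows but the first produces the
columns of M other than the last (`dwbc_special`). The remaining row, a polynomial in c and z,
combines the columns of M, with coefficient c^(n-1) at the last one (`det_special_row`). Cancelling
c^(n-1) needs c regular; arbitrary parameters follow by specialisation from a universal domain
(`mul_ZASM`). -/

namespace RefinedASM

open Matrix Kronecker

/-! ### The six-vertex model and the Yang–Baxter equation. -/

section SixVertex

variable {R S : Type*} [CommRing R] [CommRing S]

/-- Vertex weight of the empty vertices `(0, 0)` and, up to the factor `x`, `(1, 1)`. -/
def wtA (v u : R) : R := 1 - u * v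

/-- Vertex weight of the vertices with exactly one occupied line passing straight through. -/
def wtB (x y v u : R) : R := (1 - y * u) * (1 - v) - x * u * v

/-- Vertex weight of an entry `-1`. -/
def wtC (x y v u : R) : R := (y - (1 + y - x) * v + v ^ 2) * (1 - (1 + y - x) * u + y * u ^ 2)

/-- The vertex weight, as a matrix in the horizontal bits, for vertical bits `s` above and `t`
below. -/
def vertex (x y v u : R) (s t : Bool) : Matrix Bool Bool R :=
  fun r q =>
    match s, t, r, q with
    | false, false, false, false => wtA v u
    | false, false, true, true => wtB x y v u
    | true, true, false, false => wtB x y v u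
    | true, true, true, true => x * wtA v u
    | false, true, false, true => 1
    | true, false, true, false => wtC x y v u
    | _, _, _, _ => 0

/-- The transfer matrix of a row with left boundary bit `0` and right boundary bit `1`. -/
def rowMatrix (x y : R) {n : ℕ} (v : R) (u : Fin n → R) :
    Matrix (Fin n → Bool) (Fin n → Bool) R :=
  Matrix.of fun s t => (List.ofFn fun j => vertex x y v (u j) (s j) (t j)).prod false true

/-- The partition function with domain wall boundary conditions. -/
def dwbc (x y : R) {m n : ℕ} (v : Fin m → R) (u : Fin n → R) : R :=
  (List.ofFn fun i => rowMatrix x y (v i) u).prod (fun _ => false) (fun _ => true)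

/-- The intertwiner of two rows. -/
def rMatrix (x y v w : R) : Matrix (Bool × Bool) (Bool × Bool) R :=
  fun r q =>
    match r, q with
    | (false, false), (false, false) => y - (y - x) * v - w + v * w
    | (true, true), (true, true) => y - (y - x) * v - w + v * w
    | (false, true), (false, true) => y - (1 + y - x) * v + v ^ 2
    | (true, false), (true, false) => y - (1 + y - x) * w + w ^ 2
    | (false, true), (true, false) => x * (v - w)
    | (true, false), (false, true) => v - w
    | _, _ => 0

-- The local exchange relation behind the symmetry in the row parameters. For each choice of the
-- outer bits it is a polynomial identity in the parameters.
set_option maxHeartbeats 2000000 in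
theorem yang_baxter (x y v w u : R) (s t : Bool) :
    rMatrix x y v w * ∑ m, vertex x y v u s m ⊗ₖ vertex x y w u m t =
      (∑ m, vertex x y w u s m ⊗ₖ vertex x y v u m t) * rMatrix x y v w := by
  ext ⟨a, b⟩ ⟨c, d⟩
  cases s <;> cases t <;> cases a <;> cases b <;> cases c <;> cases d <;>
    simp only [Matrix.mul_apply, Fintype.sum_prod_type, vertex, rMatrix, Fintype.sum_bool,
      Matrix.add_apply, kroneckerMap_apply, mul_zero, zero_mul, add_zero, zero_add, mul_one,
      one_mul] <;>
    simp only [wtA, wtB, wtC] <;> ring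

theorem sum_prod_ofFn {A ι : Type*} [Semiring A] [Fintype ι] :
    ∀ {n : ℕ} (f : Fin n → ι → A),
      ∑ m : Fin n → ι, (List.ofFn fun j => f j (m j)).prod = (List.ofFn fun j => ∑ b, f j b).prod
  | 0, f => by simp
  | n + 1, f => by
    rw [← (Fin.consEquiv fun _ => ι).sum_comp, Fintype.sum_prod_type]
    simp only [List.ofFn_succ, List.prod_cons, ← sum_prod_ofFn fun j => f j.succ, Finset.sum_mul,
      Fin.consEquiv_apply, Fin.cons_zero, Fin.cons_succ, Finset.mul_sum]
    exact Finset.sum_comm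

theorem prod_ofFn_kronecker {α β : Type*} [Fintype α] [Fintype β] [DecidableEq α] [DecidableEq β] :
    ∀ {n : ℕ} (f : Fin n → Matrix α α R) (g : Fin n → Matrix β β R),
      (List.ofFn f).prod ⊗ₖ (List.ofFn g).prod = (List.ofFn fun j => f j ⊗ₖ g j).prod
  | 0, f, g => by simp
  | n + 1, f, g => by
    simp only [List.ofFn_succ, List.prod_cons, ← prod_ofFn_kronecker, mul_kronecker_mul]

theorem semiconjBy_prod_ofFn {A : Type*} [Monoid A] (r : A) :
    ∀ {n : ℕ} (f g : Fin n → A), (∀ j, SemiconjBy r (f j) (g j)) →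
      SemiconjBy r (List.ofFn f).prod (List.ofFn g).prod
  | 0, f, g, _ => by simp
  | n + 1, f, g, h => by
    simp only [List.ofFn_succ, List.prod_cons]
    exact (h 0).mul_right (semiconjBy_prod_ofFn r _ _ fun j => h j.succ)

theorem rowMatrix_mul_apply (x y v w : R) {n : ℕ} (u : Fin n → R) (s t : Fin n → Bool) :
    (rowMatrix x y v u * rowMatrix x y w u) s t =
      (List.ofFn fun j => ∑ m, vertex x y v (u j) (s j) m ⊗ₖ vertex x y w (u j) m (t j)).prod
        (false, false) (true, true) := by
  rw [← sum_prod_ofFn, Matrix.sum_apply, Matrix.mul_apply]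
  refine Finset.sum_congr rfl fun m _ => ?_
  rw [← prod_ofFn_kronecker]
  rfl

/-- The row of `rMatrix` at `(false, false)` and its column at `(true, true)` have only their
diagonal entries, which coincide. At the boundary bits of two full rows the intertwiner is therefore
a scalar. -/
theorem rMatrix_intertwine (x y v w : R) {M N : Matrix (Bool × Bool) (Bool × Bool) R}
    (h : rMatrix x y v w * M = N * rMatrix x y v w) :
    (y - (y - x) * v - w + v * w) * M (false, false) (true, true) =
      (y - (y - x) * v - w + v * w) * N (false, false) (true, true) := by
  have h' := congr_fun₂ h (false, false) (true, true)
  rw [Matrix.mul_apply, Matrix.mul_apply] at h'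
  simp only [Fintype.sum_prod_type, Fintype.sum_bool, rMatrix, zero_mul, mul_zero, add_zero,
    zero_add] at h'
  rw [h', mul_comm]

theorem mul_rowMatrix_mul_comm (x y v w : R) {n : ℕ} (u : Fin n → R) :
    (y - (y - x) * v - w + v * w) • (rowMatrix x y v u * rowMatrix x y w u) =
      (y - (y - x) * v - w + v * w) • (rowMatrix x y w u * rowMatrix x y v u) := by
  ext s t
  have h := semiconjBy_prod_ofFn (rMatrix x y v w) _ _ fun j => yang_baxter x y v w (u j) (s j) (t j)
  rw [Matrix.smul_apply, Matrix.smul_apply, rowMatrix_mul_apply, rowMatrix_mul_apply, smul_eq_mul,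
    smul_eq_mul]
  exact rMatrix_intertwine x y v w h.eq

theorem map_vertex (f : R →+* S) (x y v u : R) (s t : Bool) :
    (vertex x y v u s t).map f = vertex (f x) (f y) (f v) (f u) s t := by
  ext r q
  cases s <;> cases t <;> cases r <;> cases q <;> simp [vertex, wtA, wtB, wtC]

theorem map_prod_ofFn {α : Type*} [Fintype α] [DecidableEq α] (f : R →+* S) {n : ℕ}
    (M : Fin n → Matrix α α R) :
    (List.ofFn M).prod.map f = (List.ofFn fun j => (M j).map f).prod := by
  have := map_list_prod f.mapMatrix (List.ofFn M)
  rw [List.map_ofFn] at this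
  exact this

theorem map_rowMatrix (f : R →+* S) (x y v : R) {n : ℕ} (u : Fin n → R) :
    (rowMatrix x y v u).map f = rowMatrix (f x) (f y) (f v) (fun j => f (u j)) := by
  ext s t
  simp only [rowMatrix, Matrix.map_apply, Matrix.of_apply, ← map_vertex]
  rw [← map_prod_ofFn, Matrix.map_apply]

theorem map_dwbc (f : R →+* S) (x y : R) {m n : ℕ} (v : Fin m → R) (u : Fin n → R) :
    f (dwbc x y v u) = dwbc (f x) (f y) (fun i => f (v i)) (fun j => f (u j)) := by
  simp only [dwbc, ← map_rowMatrix]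
  rw [← map_prod_ofFn, Matrix.map_apply]

/-- The scalar left over by the intertwiner is nonzero for indeterminate parameters, hence can be
cancelled in a polynomial ring over ℤ; specialisation gives every ring. -/
theorem rowMatrix_commute (x y v w : R) {n : ℕ} (u : Fin n → R) :
    Commute (rowMatrix x y v u) (rowMatrix x y w u) := by
  let P := MvPolynomial (Fin 4 ⊕ Fin n) ℤ
  let X' : P := MvPolynomial.X (.inl 0)
  let Y' : P := MvPolynomial.X (.inl 1)
  let V' : P := MvPolynomial.X (.inl 2)
  let W' : P := MvPolynomial.X (.inl 3)
  let U' : Fin n → P := fun j => MvPolynomial.X (.inr j)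
  have h0 : Y' - (Y' - X') * V' - W' + V' * W' ≠ 0 := by
    intro h
    have := congrArg (MvPolynomial.eval (Sum.elim ![0, 1, 0, 0] fun _ => 0)) h
    simp [X', Y', V', W'] at this
  have hc : rowMatrix X' Y' V' U' * rowMatrix X' Y' W' U' =
      rowMatrix X' Y' W' U' * rowMatrix X' Y' V' U' :=
    smul_right_injective _ h0 (mul_rowMatrix_mul_comm X' Y' V' W' U')
  let f : P →+* R := MvPolynomial.eval₂Hom (Int.castRingHom R) (Sum.elim ![x, y, v, w] u)
  have hX : f X' = x := MvPolynomial.eval₂_X _ _ _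
  have hY : f Y' = y := MvPolynomial.eval₂_X _ _ _
  have hV : f V' = v := MvPolynomial.eval₂_X _ _ _
  have hW : f W' = w := MvPolynomial.eval₂_X _ _ _
  have hU : ∀ j, f (U' j) = u j := fun j => MvPolynomial.eval₂_X _ _ _
  have := congrArg f.mapMatrix hc
  rw [map_mul, map_mul] at this
  simp only [RingHom.mapMatrix_apply, map_rowMatrix, hX, hY, hV, hW, hU] at this
  exact this

theorem dwbc_comp_perm (x y : R) {m n : ℕ} (v : Fin m → R) (u : Fin n → R)
    (σ : Equiv.Perm (Fin m)) : dwbc x y (v ∘ σ) u = dwbc x y v u := by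
  unfold dwbc
  have h := σ.ofFn_comp_perm fun i => rowMatrix x y (v i) u
  rw [← h.prod_eq']
  · rfl
  · rw [List.pairwise_iff_forall_sublist]
    intro a b hab
    have ha := hab.subset (List.mem_cons_self)
    have hb := hab.subset (List.mem_cons_of_mem _ List.mem_cons_self)
    simp only [List.mem_ofFn] at ha hb
    obtain ⟨i, rfl⟩ := ha
    obtain ⟨j, rfl⟩ := hb
    exact rowMatrix_commute x y _ _ u

end SixVertex

end RefinedASM

namespace RefinedASM

open Matrix Polynomial

/-! ### Degrees in a single column parameter. -/

section DegreeBound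

variable {R : Type*} [CommRing R]

/-- The coefficients of `p` above the (possibly negative) integer `d` vanish. -/
def DegreeBound (p : R[X]) (d : ℤ) : Prop := ∀ k : ℕ, d < k → p.coeff k = 0

theorem DegreeBound.zero (d : ℤ) : DegreeBound (0 : R[X]) d := fun _ _ => coeff_zero _

theorem DegreeBound.of_natDegree_le {p : R[X]} {d : ℕ} (h : p.natDegree ≤ d) :
    DegreeBound p d :=
  fun _ hk => coeff_eq_zero_of_natDegree_lt (h.trans_lt (by exact_mod_cast hk))

theorem DegreeBound.C (a : R) : DegreeBound (C a) 0 :=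
  .of_natDegree_le (d := 0) (natDegree_C a).le

theorem DegreeBound.natDegree_le {p : R[X]} {d : ℕ} (h : DegreeBound p d) : p.natDegree ≤ d :=
  natDegree_le_iff_coeff_eq_zero.2 fun k hk => h k (by exact_mod_cast hk)

theorem DegreeBound.mono {p : R[X]} {d e : ℤ} (h : DegreeBound p d) (hde : d ≤ e) :
    DegreeBound p e :=
  fun k hk => h k (hde.trans_lt hk)

theorem DegreeBound.mul {p q : R[X]} {d e : ℤ} (hp : DegreeBound p d) (hq : DegreeBound q e) :
    DegreeBound (p * q) (d + e) := by
  intro k hk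
  rw [coeff_mul]
  refine Finset.sum_eq_zero fun ⟨i, j⟩ hij => ?_
  have hij' : i + j = k := Finset.HasAntidiagonal.mem_antidiagonal.1 hij
  dsimp only
  by_cases h : d < i
  · rw [hp i h, zero_mul]
  · rw [hq j (by omega), mul_zero]

theorem DegreeBound.sum {ι : Type*} {s : Finset ι} {p : ι → R[X]} {d : ℤ}
    (h : ∀ i ∈ s, DegreeBound (p i) d) : DegreeBound (∑ i ∈ s, p i) d := by
  intro k hk
  rw [finsetSum_coeff]
  exact Finset.sum_eq_zero fun i hi => h i hi k hk

/-- The -1 vertex has degree up to 2 and the +1 vertex degree 0. Writing this as a correction by the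
vertical bits makes the bound telescope down a column; intermediate bounds can be negative, hence
the integer degrees. -/
theorem DegreeBound.vertex (x y v : R) (s t r q : Bool) :
    DegreeBound (vertex (Polynomial.C x) (Polynomial.C y) (Polynomial.C v) X s t r q)
      (1 + s.toNat - t.toNat) := by
  have hA : DegreeBound (wtA (Polynomial.C v) X) 1 :=
    .of_natDegree_le (d := 1) (by unfold wtA; compute_degree)
  have hxA : DegreeBound (Polynomial.C x * wtA (Polynomial.C v) X) 1 := by
    simpa using (DegreeBound.C x).mul hA
  have hB : DegreeBound (wtB (Polynomial.C x) (Polynomial.C y) (Polynomial.C v) X) 1 :=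
    .of_natDegree_le (d := 1) (by
      unfold wtB
      have : (1 - Polynomial.C y * X) * (1 - Polynomial.C v) - Polynomial.C x * X * Polynomial.C v =
        Polynomial.C (1 - v) + Polynomial.C (- y * (1 - v) - x * v) * X := by
        simp only [map_sub, map_mul, map_neg, map_one]; ring
      rw [this]
      compute_degree)
  have hC : DegreeBound (wtC (Polynomial.C x) (Polynomial.C y) (Polynomial.C v) X) 2 :=
    .of_natDegree_le (d := 2) (by
      unfold wtC
      have : (Polynomial.C y - (1 + Polynomial.C y - Polynomial.C x) * Polynomial.C v +
          Polynomial.C v ^ 2) * (1 - (1 + Polynomial.C y - Polynomial.C x) * X +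
          Polynomial.C y * X ^ 2) = Polynomial.C (y - (1 + y - x) * v + v ^ 2) *
            (1 - Polynomial.C (1 + y - x) * X + Polynomial.C y * X ^ 2) := by
        simp only [map_sub, map_mul, map_add, map_one, map_pow]
      rw [this]
      compute_degree)
  have h1 : DegreeBound (1 : R[X]) 0 := by simpa using DegreeBound.C (1 : R)
  cases s <;> cases t <;> cases r <;> cases q <;>
    simp [RefinedASM.vertex, hA, hxA, hB, hC, h1, DegreeBound.zero]

theorem rowMatrix_succ_apply (x y v : R) {n : ℕ} (u : Fin (n + 1) → R) (s t : Fin (n + 1) → Bool) :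
    rowMatrix x y v u s t = ∑ r, vertex x y v (u 0) (s 0) (t 0) false r *
      (List.ofFn fun j : Fin n => vertex x y v (u j.succ) (s j.succ) (t j.succ)).prod r true := by
  simp only [rowMatrix, Matrix.of_apply, List.ofFn_succ, List.prod_cons, Matrix.mul_apply]

theorem DegreeBound.rowMatrix (x y v : R) {n : ℕ} (u : Fin n → R) (s t : Fin (n + 1) → Bool) :
    DegreeBound (rowMatrix (Polynomial.C x) (Polynomial.C y) (Polynomial.C v)
      (Fin.cons X fun j => Polynomial.C (u j) : Fin (n + 1) → R[X]) s t)
      (1 + (s 0).toNat - (t 0).toNat) := by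
  rw [rowMatrix_succ_apply]
  refine .sum fun r _ => ?_
  simp only [Fin.cons_zero, Fin.cons_succ, ← map_vertex, ← map_prod_ofFn, Matrix.map_apply]
  simpa using (DegreeBound.vertex x y v (s 0) (t 0) false r).mul (DegreeBound.C _)

theorem DegreeBound.prod_rowMatrix (x y : R) {n : ℕ} (u : Fin n → R) :
    ∀ {m : ℕ} (v : Fin m → R) (s t : Fin (n + 1) → Bool),
      DegreeBound ((List.ofFn fun i => RefinedASM.rowMatrix (Polynomial.C x) (Polynomial.C y)
        (Polynomial.C (v i)) (Fin.cons X fun j => Polynomial.C (u j) : Fin (n + 1) → R[X])).prod s t)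
      (m + (s 0).toNat - (t 0).toNat)
  | 0, v, s, t => by
    simp only [List.ofFn_zero, List.prod_nil, Matrix.one_apply]
    split_ifs with h
    · subst h
      simpa using DegreeBound.C (1 : R)
    · exact .zero _
  | m + 1, v, s, t => by
    simp only [List.ofFn_succ, List.prod_cons, Matrix.mul_apply]
    refine .sum fun r _ => ?_
    refine ((DegreeBound.rowMatrix x y (v 0) u s r).mul
      (DegreeBound.prod_rowMatrix x y u (fun i => v i.succ) r t)).mono ?_
    push_cast
    linarith

theorem DegreeBound.prod {ι : Type*} (s : Finset ι) {p : ι → R[X]} {d : ι → ℕ}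
    (h : ∀ i ∈ s, (p i).natDegree ≤ d i) : DegreeBound (∏ i ∈ s, p i) (∑ i ∈ s, d i : ℕ) :=
  .of_natDegree_le ((natDegree_prod_le _ _).trans (Finset.sum_le_sum h))

end DegreeBound

/-! ### Freezing, and the matching recursion of the determinant. -/

section Recursion

variable {R S : Type*} [CommRing R] [CommRing S]

/-- With empty edges above, an occupied horizontal line cannot turn down, since no allowed vertex
has both incoming horizontal bit 1 and lower bit 1; all vertices are straight. -/
theorem prod_vertex_true_true (x y v : R) :
    ∀ {n : ℕ} (u : Fin n → R) (t : Fin n → Bool),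
      (List.ofFn fun j => vertex x y v (u j) false (t j)).prod true true =
        if t = (fun _ => false) then ∏ j, wtB x y v (u j) else 0
  | 0, u, t => by simp [Subsingleton.elim t fun _ => false]
  | n + 1, u, t => by
    have ht : t = (fun _ => false) ↔ t 0 = false ∧ (fun j : Fin n => t j.succ) = fun _ => false := by
      simp only [funext_iff, Fin.forall_fin_succ]
    simp only [List.ofFn_succ, List.prod_cons, Matrix.mul_apply, Fintype.sum_bool,
      prod_vertex_true_true x y v (fun j => u j.succ), ht, Fin.prod_univ_succ]
    cases t 0 <;> simp [vertex]

/-- Once the empty corner vertex has weight 0, the corner must hold the entry 1, and this forces the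
rest of the row. -/
theorem rowMatrix_zero_apply (x y v : R) {n : ℕ} (u : Fin (n + 1) → R) (h : wtA v (u 0) = 0)
    (t : Fin (n + 1) → Bool) :
    rowMatrix x y v u (fun _ => false) t =
      if t = (Fin.cons true fun _ => false : Fin (n + 1) → Bool) then
        ∏ j : Fin n, wtB x y v (u j.succ) else 0 := by
  have ht : t = (Fin.cons true fun _ => false : Fin (n + 1) → Bool) ↔
      t 0 = true ∧ (fun j : Fin n => t j.succ) = fun _ => false := by
    simp [funext_iff, Fin.forall_fin_succ]
  simp only [rowMatrix_succ_apply, Fintype.sum_bool, prod_vertex_true_true, ht]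
  cases t 0 <;> simp [vertex, h]

theorem prod_rowMatrix_cons_true (x y : R) {n : ℕ} (u : Fin (n + 1) → R) :
    ∀ {m : ℕ} (v : Fin m → R) (s t : Fin n → Bool),
      (List.ofFn fun i => rowMatrix x y (v i) u).prod (Fin.cons true s : Fin (n + 1) → Bool)
          (Fin.cons true t : Fin (n + 1) → Bool) =
        (∏ i, wtB x y (v i) (u 0)) *
          (List.ofFn fun i => rowMatrix x y (v i) fun j => u j.succ).prod s t
  | 0, v, s, t => by
    simp [Matrix.one_apply]
  | m + 1, v, s, t => by
    have h1 : ∀ r : Fin n → Bool, rowMatrix x y (v 0) u (Fin.cons true s : Fin (n + 1) → Bool)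
        (Fin.cons true r : Fin (n + 1) → Bool) =
        wtB x y (v 0) (u 0) * rowMatrix x y (v 0) (fun j => u j.succ) s r := fun r => by
      rw [rowMatrix_succ_apply]
      simp [vertex, rowMatrix]
    have h0 : ∀ r : Fin n → Bool, rowMatrix x y (v 0) u (Fin.cons true s : Fin (n + 1) → Bool)
        (Fin.cons false r : Fin (n + 1) → Bool) = 0 := fun r => by
      rw [rowMatrix_succ_apply]
      simp [vertex]
    simp only [List.ofFn_succ, List.prod_cons, Matrix.mul_apply]
    rw [← (Fin.consEquiv fun _ => Bool).sum_comp, Fintype.sum_prod_type]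
    simp only [Fintype.sum_bool, Fin.consEquiv, Equiv.coe_fn_mk, h0, h1, zero_mul, Finset.sum_const_zero,
      add_zero, prod_rowMatrix_cons_true x y u (fun i => v i.succ), Fin.prod_univ_succ,
      Finset.mul_sum]
    exact Finset.sum_congr rfl fun r _ => by ring

theorem dwbc_succ_of_wtA_eq_zero (x y : R) {n : ℕ} (v u : Fin (n + 1) → R)
    (h : wtA (v 0) (u 0) = 0) :
    dwbc x y v u = (∏ i : Fin n, wtB x y (v i.succ) (u 0)) *
      (∏ j : Fin n, wtB x y (v 0) (u j.succ)) * dwbc x y (fun i => v i.succ) fun j => u j.succ := by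
  have ht : (fun _ => true : Fin (n + 1) → Bool) = Fin.cons true fun _ => true := by
    ext j; refine Fin.cases rfl (fun _ => rfl) j
  simp only [dwbc, List.ofFn_succ, List.prod_cons, Matrix.mul_apply, rowMatrix_zero_apply x y _ u h,
    ite_mul, zero_mul, Finset.sum_ite_eq', Finset.mem_univ, if_true]
  rw [ht, prod_rowMatrix_cons_true x y u fun i : Fin n => v i.succ]
  ring

theorem det_vandermonde_succ {n : ℕ} (u : Fin (n + 1) → R) :
    (vandermonde u).det =
      (∏ j : Fin n, (u j.succ - u 0)) * (vandermonde fun j : Fin n => u j.succ).det := by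
  simp only [det_vandermonde, Fin.prod_univ_succ, Fin.prod_Ioi_zero, Fin.prod_Ioi_succ]

theorem map_det_vandermonde (f : R →+* S) {n : ℕ} (u : Fin n → R) :
    f (vandermonde u).det = (vandermonde fun j => f (u j)).det := by
  simp [det_vandermonde]

/-- The matrix `1 / (wtA * wtB)` with cleared denominators. -/
def ikMatrix (x y : R) {n : ℕ} (v u : Fin n → R) : Matrix (Fin n) (Fin n) R :=
  Matrix.of fun i j => ∏ m, if m = i then 1 else wtA (v m) (u j) * wtB x y (v m) (u j)

theorem map_ikMatrix (f : R →+* S) (x y : R) {n : ℕ} (v u : Fin n → R) :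
    (ikMatrix x y v u).map f = ikMatrix (f x) (f y) (fun i => f (v i)) (fun j => f (u j)) := by
  ext i j
  simp only [ikMatrix, Matrix.map_apply, Matrix.of_apply, map_prod]
  refine Finset.prod_congr rfl fun m _ => ?_
  split_ifs <;> simp [wtA, wtB]

theorem map_det_ikMatrix (f : R →+* S) (x y : R) {n : ℕ} (v u : Fin n → R) :
    f (ikMatrix x y v u).det =
      (ikMatrix (f x) (f y) (fun i => f (v i)) (fun j => f (u j))).det := by
  rw [RingHom.map_det, RingHom.mapMatrix_apply, map_ikMatrix]

theorem det_ikMatrix_comp_perm (x y : R) {n : ℕ} (v u : Fin n → R) (σ : Equiv.Perm (Fin n)) :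
    (ikMatrix x y (v ∘ σ) u).det = σ.sign * (ikMatrix x y v u).det := by
  rw [← det_permute]
  congr 1
  ext i j
  simp only [ikMatrix, Matrix.of_apply, Matrix.submatrix_apply, id, Function.comp_apply]
  refine Eq.trans ?_ (Equiv.prod_comp σ fun m =>
    if m = σ i then 1 else wtA (v m) (u j) * wtB x y (v m) (u j))
  simp

theorem det_vandermonde_comp_perm {n : ℕ} (v : Fin n → R) (σ : Equiv.Perm (Fin n)) :
    (vandermonde (v ∘ σ)).det = σ.sign * (vandermonde v).det := by
  rw [← det_permute]
  rfl

theorem det_ikMatrix_eq_zero (x y : R) {n : ℕ} (v u : Fin n → R) {i j : Fin n} (hij : i ≠ j)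
    (h : u i = u j) : (ikMatrix x y v u).det = 0 :=
  det_zero_of_column_eq hij fun k => by simp [ikMatrix, h]

theorem ikMatrix_minor (x y : R) {n : ℕ} (v u : Fin (n + 1) → R) (i j : Fin n) :
    ikMatrix x y v u i.succ j.succ = wtA (v 0) (u j.succ) * wtB x y (v 0) (u j.succ) *
      ikMatrix x y (fun i => v i.succ) (fun j => u j.succ) i j := by
  simp [ikMatrix, Fin.prod_univ_succ, (Fin.succ_ne_zero i).symm]

/-- Below the corner, every entry of the first column contains the vanishing factor with `m = 0`. -/
theorem det_ikMatrix_succ_of_wtA_eq_zero (x y : R) {n : ℕ} (v u : Fin (n + 1) → R)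
    (h : wtA (v 0) (u 0) = 0) :
    (ikMatrix x y v u).det = (∏ i : Fin n, wtA (v i.succ) (u 0) * wtB x y (v i.succ) (u 0)) *
      ((∏ j : Fin n, wtA (v 0) (u j.succ) * wtB x y (v 0) (u j.succ)) *
        (ikMatrix x y (fun i => v i.succ) fun j => u j.succ).det) := by
  rw [det_succ_column_zero, Fin.sum_univ_succ, Finset.sum_eq_zero, add_zero, ← det_mul_row]
  · have h0 : ikMatrix x y v u 0 0 =
        ∏ i : Fin n, wtA (v i.succ) (u 0) * wtB x y (v i.succ) (u 0) := by
      simp [ikMatrix, Fin.prod_univ_succ]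
    rw [h0, Fin.val_zero, pow_zero, one_mul]
    congr 2
    ext i j
    simp only [Matrix.submatrix_apply, Fin.succAbove_zero, ikMatrix_minor, Matrix.of_apply]
  · intro i _
    have h0 : ikMatrix x y v u i.succ 0 = 0 := by
      simp [ikMatrix, Fin.prod_univ_succ, (Fin.succ_ne_zero i).symm, h]
    rw [h0, mul_zero, zero_mul]

end Recursion

/-! ### The Izergin–Korepin formula. -/

section IzerginKorepin

variable {R : Type*} [CommRing R]

theorem dwbc_mul_vandermonde_of_pole {K : Type*} [Field K] (x y : K) {n : ℕ}
    (v u : Fin (n + 1) → K) (h : u 0 * v 0 = 1)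
    (ih : dwbc x y (fun i => v i.succ) (fun j => u j.succ) *
      (vandermonde fun i => v i.succ).det * (vandermonde fun j => u j.succ).det =
        (ikMatrix x y (fun i => v i.succ) fun j => u j.succ).det) :
    dwbc x y v u * (vandermonde v).det * (vandermonde u).det = (ikMatrix x y v u).det := by
  have h0 : wtA (v 0) (u 0) = 0 := by rw [wtA, h, sub_self]
  rw [dwbc_succ_of_wtA_eq_zero x y v u h0, det_ikMatrix_succ_of_wtA_eq_zero x y v u h0, ← ih,
    det_vandermonde_succ v, det_vandermonde_succ u]
  -- The Vandermonde factors of the removed row and column match the surplus `wtA` factors of the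
  -- determinant: if u_0 v_0 = 1, then (v - v_0)(u - u_0) = (1 - u_0 v)(1 - u v_0).
  have key : (∏ i : Fin n, (v i.succ - v 0)) * (∏ j : Fin n, (u j.succ - u 0)) =
      (∏ i : Fin n, wtA (v i.succ) (u 0)) * ∏ j : Fin n, wtA (v 0) (u j.succ) := by
    rw [← Finset.prod_mul_distrib, ← Finset.prod_mul_distrib]
    refine Finset.prod_congr rfl fun i _ => ?_
    simp only [wtA]
    linear_combination (1 - u i.succ * v i.succ) * h
  rw [Finset.prod_mul_distrib, Finset.prod_mul_distrib]
  linear_combination (∏ i : Fin n, wtB x y (v i.succ) (u 0)) *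
    (∏ j : Fin n, wtB x y (v 0) (u j.succ)) * (dwbc x y (fun i => v i.succ) (fun j => u j.succ) *
      (vandermonde fun i => v i.succ).det * (vandermonde fun j => u j.succ).det) * key

theorem natDegree_dwbc_mul_vandermonde (x y : R) {n : ℕ}
    (v : Fin (n + 1) → R) (u : Fin n → R) :
    (dwbc (C x) (C y) (fun i => C (v i)) (Fin.cons X fun j => C (u j) : Fin (n + 1) → R[X]) *
      (vandermonde fun i => C (v i)).det *
      (vandermonde (Fin.cons X fun j => C (u j) : Fin (n + 1) → R[X])).det).natDegree ≤ 2 * n := by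
  refine DegreeBound.natDegree_le ?_
  have e1 : DegreeBound (dwbc (C x) (C y) (fun i => C (v i))
      (Fin.cons X fun j => C (u j) : Fin (n + 1) → R[X])) n := by
    refine (DegreeBound.prod_rowMatrix x y u v _ _).mono ?_
    simp
  have e2 : DegreeBound (vandermonde fun i => C (v i)).det 0 := by
    rw [← map_det_vandermonde]
    exact .C _
  have e3 : DegreeBound (vandermonde (Fin.cons X fun j => C (u j) : Fin (n + 1) → R[X])).det n := by
    rw [det_vandermonde_succ]
    simp only [Fin.cons_succ, Fin.cons_zero]
    have h1 : DegreeBound (∏ j : Fin n, (C (u j) - X)) (∑ j : Fin n, 1 : ℕ) :=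
      .prod _ fun j _ => by compute_degree
    have h2 : DegreeBound (vandermonde fun j : Fin n => C (u j)).det 0 := by
      rw [← map_det_vandermonde]
      exact .C _
    simpa using h1.mul h2
  refine ((e1.mul e2).mul e3).mono ?_
  push_cast
  linarith

theorem natDegree_wtA_mul_wtB (x y v : R) :
    (wtA (C v) X * wtB (C x) (C y) (C v) X).natDegree ≤ 2 := by
  have hA : DegreeBound (wtA (C v) X) (1 : ℕ) := by
    simpa [vertex] using DegreeBound.vertex x y v false false false false
  have hB : DegreeBound (wtB (C x) (C y) (C v) X) (1 : ℕ) := by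
    simpa [vertex] using DegreeBound.vertex x y v false false true true
  exact natDegree_mul_le.trans (Nat.add_le_add hA.natDegree_le hB.natDegree_le)

/-- Only the first column involves the indeterminate, and each of its entries has `n` factors of
degree at most 2. -/
theorem natDegree_det_ikMatrix (x y : R) {n : ℕ}
    (v : Fin (n + 1) → R) (u : Fin n → R) :
    (ikMatrix (C x) (C y) (fun i => C (v i))
      (Fin.cons X fun j => C (u j) : Fin (n + 1) → R[X])).det.natDegree ≤ 2 * n := by
  refine DegreeBound.natDegree_le ?_
  rw [det_succ_column_zero]
  refine .sum fun i _ => ?_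
  have e1 : DegreeBound (((-1) ^ (i : ℕ) : R[X])) 0 := by
    simpa using DegreeBound.C ((-1) ^ (i : ℕ) : R)
  have e2 : DegreeBound (ikMatrix (C x) (C y) (fun i => C (v i))
      (Fin.cons X fun j => C (u j) : Fin (n + 1) → R[X]) i 0)
      (∑ m : Fin (n + 1), (if m = i then 0 else 2) : ℕ) := by
    simp only [ikMatrix, Matrix.of_apply, Fin.cons_zero]
    refine .prod _ fun m _ => ?_
    split_ifs
    · simp
    · exact natDegree_wtA_mul_wtB x y (v m)
  have e3 : DegreeBound ((ikMatrix (C x) (C y) (fun i => C (v i))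
      (Fin.cons X fun j => C (u j) : Fin (n + 1) → R[X])).submatrix i.succAbove Fin.succ).det 0 := by
    have : (ikMatrix (C x) (C y) (fun i => C (v i))
        (Fin.cons X fun j => C (u j) : Fin (n + 1) → R[X])).submatrix i.succAbove Fin.succ =
        ((ikMatrix x y v (Fin.cons 0 u : Fin (n + 1) → R)).submatrix i.succAbove Fin.succ).map C := by
      ext1 a b
      rw [Matrix.map_apply, Matrix.submatrix_apply, Matrix.submatrix_apply,
        ← Matrix.map_apply (f := C) (M := ikMatrix x y v _), map_ikMatrix]
      simp only [ikMatrix, Matrix.of_apply, Fin.cons_succ]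
    rw [this, ← RingHom.mapMatrix_apply, ← RingHom.map_det]
    exact .C _
  refine ((e1.mul e2).mul e3).mono ?_
  rw [Finset.sum_ite, Finset.sum_const_zero, Finset.sum_const, Finset.filter_ne',
    Finset.card_erase_of_mem (Finset.mem_univ _), Finset.card_univ, Fintype.card_fin]
  push_cast
  simp [mul_comm]

/-- As polynomials in the first column parameter both sides have degree at most `2 * n` in size `n +
1`. They agree at the `n` other column parameters, where both vanish, and at the `n + 1` inverses of
row parameters; the hypotheses keep these points distinct. -/
theorem dwbc_mul_vandermonde_field {K : Type*} [Field K] (x y : K) {n : ℕ} (v u : Fin n → K)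
    (hv : Function.Injective v) (hu : Function.Injective u) (h0 : ∀ i, v i ≠ 0)
    (h1 : ∀ i j, u j * v i ≠ 1) :
    dwbc x y v u * (vandermonde v).det * (vandermonde u).det = (ikMatrix x y v u).det := by
  induction n with
  | zero => simp [dwbc, Matrix.one_apply, funext_iff]
  | succ n ih =>
    set u' : Fin n → K := fun j => u j.succ with hu'
    set U : Fin (n + 1) → K[X] := Fin.cons X fun j => C (u' j) with hU
    set P : K[X] := dwbc (C x) (C y) (fun i => C (v i)) U * (vandermonde fun i => C (v i)).det *
      (vandermonde U).det with hP
    set Q : K[X] := (ikMatrix (C x) (C y) (fun i => C (v i)) U).det with hQ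
    have hUe : ∀ T : K, (fun j => (U j).eval T) = (Fin.cons T u' : Fin (n + 1) → K) := fun T => by
      ext j
      refine Fin.cases ?_ (fun j => ?_) j <;> simp [hU]
    have hPe : ∀ T : K, P.eval T = dwbc x y v (Fin.cons T u' : Fin (n + 1) → K) *
        (vandermonde v).det * (vandermonde (Fin.cons T u' : Fin (n + 1) → K)).det := fun T => by
      rw [hP, ← coe_evalRingHom, map_mul, map_mul, map_dwbc, map_det_vandermonde,
        map_det_vandermonde]
      simp only [coe_evalRingHom, eval_C, hUe]
    have hQe : ∀ T : K, Q.eval T = (ikMatrix x y v (Fin.cons T u' : Fin (n + 1) → K)).det :=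
      fun T => by
        rw [hQ, ← coe_evalRingHom, map_det_ikMatrix]
        simp only [coe_evalRingHom, eval_C, hUe]
    have hPd : P.natDegree ≤ 2 * n := by
      rw [hP]
      exact natDegree_dwbc_mul_vandermonde x y v u'
    have hQd : Q.natDegree ≤ 2 * n := by
      rw [hQ]
      exact natDegree_det_ikMatrix x y v u'
    have hinj : Function.Injective (Sum.elim u' fun i => (v i)⁻¹) := by
      refine Function.Injective.sumElim (hu.comp (Fin.succ_injective n))
        (inv_injective.comp hv) fun j i h => h1 i j.succ ?_
      rw [show u j.succ = (v i)⁻¹ from h, inv_mul_cancel₀ (h0 i)]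
    have hPQ : P = Q := by
      refine eq_of_natDegree_lt_card_of_eval_eq P Q hinj ?_ ?_
      · rintro (j | k)
        · rw [Sum.elim_inl, hPe, hQe]
          have hz : (Fin.cons (u' j) u' : Fin (n + 1) → K) j.succ =
            (Fin.cons (u' j) u' : Fin (n + 1) → K) 0 := by simp
          rw [det_ikMatrix_eq_zero x y v _ (Fin.succ_ne_zero j) hz,
            det_vandermonde_eq_zero_iff.2 ⟨j.succ, 0, hz, Fin.succ_ne_zero j⟩, mul_zero]
        · rw [Sum.elim_inr, hPe, hQe]
          -- Symmetry in the rows moves row `k` to the front, where the corner freezes; the two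
          -- signs cancel.
          set σ := Equiv.swap 0 k
          have hs : (σ.sign : K) * σ.sign = 1 := by
            rw [← Int.cast_mul, ← Units.val_mul, Int.units_mul_self]; simp
          have := dwbc_mul_vandermonde_of_pole x y (v ∘ σ) (Fin.cons (v k)⁻¹ u' : Fin (n + 1) → K)
            (by simp [σ, h0 k]) (by
              simp only [Fin.cons_succ]
              exact ih _ u'
                ((hv.comp σ.injective).comp (Fin.succ_injective n))
                (hu.comp (Fin.succ_injective n)) (fun i => h0 _) fun i j => h1 _ _)
          rw [dwbc_comp_perm, det_ikMatrix_comp_perm, det_vandermonde_comp_perm] at this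
          linear_combination (σ.sign : K) * this - (dwbc x y v (Fin.cons (v k)⁻¹ u' : Fin (n + 1) → K) *
            (vandermonde v).det * (vandermonde (Fin.cons (v k)⁻¹ u' : Fin (n + 1) → K)).det -
            (ikMatrix x y v (Fin.cons (v k)⁻¹ u' : Fin (n + 1) → K)).det) * hs
      · simp only [Fintype.card_sum, Fintype.card_fin]
        omega
    have := congrArg (eval (u 0)) hPQ
    rw [hPe, hQe] at this
    have hc : (Fin.cons (u 0) u' : Fin (n + 1) → K) = u := Fin.cons_self_tail u
    rwa [hc] at this

/-- The Izergin–Korepin determinant formula. -/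
theorem dwbc_mul_vandermonde (x y : R) {n : ℕ} (v u : Fin n → R) :
    dwbc x y v u * (vandermonde v).det * (vandermonde u).det = (ikMatrix x y v u).det := by
  let P := MvPolynomial (Fin 2 ⊕ Fin n ⊕ Fin n) ℤ
  let X' : P := MvPolynomial.X (.inl 0)
  let Y' : P := MvPolynomial.X (.inl 1)
  let V' : Fin n → P := fun i => MvPolynomial.X (.inr (.inl i))
  let U' : Fin n → P := fun j => MvPolynomial.X (.inr (.inr j))
  have key : dwbc X' Y' V' U' * (vandermonde V').det * (vandermonde U').det =
      (ikMatrix X' Y' V' U').det := by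
    have hinj : Function.Injective (algebraMap P (FractionRing P)) :=
      IsFractionRing.injective P (FractionRing P)
    apply hinj
    rw [map_mul, map_mul, map_dwbc, map_det_vandermonde, map_det_vandermonde, map_det_ikMatrix]
    refine dwbc_mul_vandermonde_field _ _ _ _
      (hinj.comp fun i j h => by simpa using MvPolynomial.X_injective h)
      (hinj.comp fun i j h => by simpa using MvPolynomial.X_injective h) (fun i h => ?_)
      fun i j h => ?_
    · exact MvPolynomial.X_ne_zero _ (hinj (h.trans (map_zero _).symm))
    · rw [← map_mul, ← map_one (algebraMap P (FractionRing P))] at h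
      have := congrArg (MvPolynomial.eval fun _ => 0) (hinj h)
      rw [map_mul, MvPolynomial.eval_X, zero_mul, map_one] at this
      exact zero_ne_one this
  let f : P →+* R := MvPolynomial.eval₂Hom (Int.castRingHom R)
    (Sum.elim ![x, y] (Sum.elim v u))
  have hX : f X' = x := MvPolynomial.eval₂_X _ _ _
  have hY : f Y' = y := MvPolynomial.eval₂_X _ _ _
  have hV : ∀ i, f (V' i) = v i := fun i => MvPolynomial.eval₂_X _ _ _
  have hU : ∀ j, f (U' j) = u j := fun j => MvPolynomial.eval₂_X _ _ _
  have := congrArg f key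
  rw [map_mul, map_mul, map_dwbc, map_det_vandermonde, map_det_vandermonde, map_det_ikMatrix] at this
  simpa only [hX, hY, hV, hU] using this

end IzerginKorepin

end RefinedASM

namespace RefinedASM

open Matrix

/-! ### Alternating sequences and bits of partial sums. -/

section PartialSums

variable {n : ℕ}

theorem Alternates.rev {f : Fin n → ℤ} (hf : Alternates f) : Alternates fun j => f j.rev := by
  intro j j' hjj hj hj' h
  have := hf j'.rev j.rev (Fin.rev_lt_rev.2 hjj) hj' hj fun k hk hk' => by
    simpa using h k.rev (by rwa [← Fin.rev_lt_rev, Fin.rev_rev])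
      (by rwa [← Fin.rev_lt_rev, Fin.rev_rev])
  dsimp only
  rw [this, neg_neg]

/-- The complementary suffix is a prefix of the reversed sequence, hence has nonnegative sum, while
the total is 1. -/
theorem Alternates.prefix_le_one {f : Fin n → ℤ} (hf : Alternates f)
    (he : ∀ j, f j = 0 ∨ f j = 1 ∨ f j = -1) (hs : ∑ j, f j = 1) (m : ℕ) (hm : m ≤ n) :
    ∑ j ∈ Finset.univ.filter (fun j : Fin n => j.val < m), f j ≤ 1 := by
  have h := hf.rev.prefix_nonneg (fun j => he j.rev) (by rw [← hs]; exact Equiv.sum_comp Fin.revPerm f)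
    (n - m) (by omega)
  have e : ∑ j ∈ Finset.univ.filter (fun j : Fin n => j.val < n - m), f j.rev =
      ∑ j ∈ Finset.univ.filter (fun j : Fin n => ¬ j.val < m), f j := by
    refine Finset.sum_bij (fun j _ => j.rev) ?_ (fun j _ j' _ h => Fin.rev_injective h) ?_
      fun _ _ => rfl
    · intro j hj
      simp only [Finset.mem_filter, Finset.mem_univ, true_and, Fin.val_rev] at hj ⊢
      omega
    · intro j hj
      refine ⟨j.rev, ?_, Fin.rev_rev j⟩
      simp only [Finset.mem_filter, Finset.mem_univ, true_and, Fin.val_rev] at hj ⊢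
      omega
  have := Finset.sum_filter_add_sum_filter_not Finset.univ (fun j : Fin n => j.val < m) f
  rw [e] at h
  omega

theorem sum_filter_succ (f : Fin n → ℤ) (j : Fin n) :
    ∑ k ∈ Finset.univ.filter (fun k : Fin n => k.val < j.val + 1), f k =
      f j + ∑ k ∈ Finset.univ.filter (fun k : Fin n => k.val < j.val), f k := by
  rw [← Finset.sum_insert (by simp)]
  congr 1
  ext k
  simp only [Finset.mem_filter, Finset.mem_univ, true_and, Finset.mem_insert, Fin.ext_iff]
  omega

/-- Whether the sum of the first `k` terms is `1`. -/
def partialBit (f : Fin n → ℤ) (k : Fin (n + 1)) : Bool :=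
  decide (∑ j ∈ Finset.univ.filter (fun j : Fin n => j.val < k.val), f j = 1)

theorem toNat_partialBit {f : Fin n → ℤ} (hf : Alternates f)
    (he : ∀ j, f j = 0 ∨ f j = 1 ∨ f j = -1) (hs : ∑ j, f j = 1) (k : Fin (n + 1)) :
    ((partialBit f k).toNat : ℤ) =
      ∑ j ∈ Finset.univ.filter (fun j : Fin n => j.val < k.val), f j := by
  have h0 := hf.prefix_nonneg he hs k.val (by omega)
  have h1 := hf.prefix_le_one he hs k.val (by omega)
  unfold partialBit
  by_cases h : ∑ j ∈ Finset.univ.filter (fun j : Fin n => j.val < k.val), f j = 1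
  · simp [h]
  · simp only [h, decide_false, Bool.toNat_false]
    push_cast
    omega

theorem partialBit_zero (f : Fin n → ℤ) : partialBit f 0 = false := by
  simp [partialBit]

theorem partialBit_last {f : Fin n → ℤ} (hs : ∑ j, f j = 1) : partialBit f (Fin.last n) = true := by
  simp [partialBit, hs]

theorem partialBit_succ_sub {f : Fin n → ℤ} (hf : Alternates f)
    (he : ∀ j, f j = 0 ∨ f j = 1 ∨ f j = -1) (hs : ∑ j, f j = 1) (j : Fin n) :
    ((partialBit f j.succ).toNat : ℤ) - (partialBit f j.castSucc).toNat = f j := by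
  rw [toNat_partialBit hf he hs, toNat_partialBit hf he hs, Fin.val_succ, sum_filter_succ]
  simp

section OfBits

variable {f : Fin n → ℤ} {b : Fin (n + 1) → Bool}

theorem sum_filter_of_bits (h0 : b 0 = false)
    (h : ∀ j : Fin n, f j = ((b j.succ).toNat : ℤ) - (b j.castSucc).toNat) (k : Fin (n + 1)) :
    ∑ j ∈ Finset.univ.filter (fun j : Fin n => j.val < k.val), f j = (b k).toNat := by
  induction k using Fin.induction with
  | zero => simp [h0]
  | succ j ih =>
    rw [Fin.val_castSucc] at ih
    rw [Fin.val_succ, sum_filter_succ, ih, h]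
    ring

theorem partialBit_of_bits (h0 : b 0 = false)
    (h : ∀ j : Fin n, f j = ((b j.succ).toNat : ℤ) - (b j.castSucc).toNat) : partialBit f = b := by
  ext k
  rw [partialBit, sum_filter_of_bits h0 h]
  cases b k <;> simp

theorem sum_of_bits (h0 : b 0 = false) (h1 : b (Fin.last n) = true)
    (h : ∀ j : Fin n, f j = ((b j.succ).toNat : ℤ) - (b j.castSucc).toNat) : ∑ j, f j = 1 := by
  simpa [h1] using sum_filter_of_bits h0 h (Fin.last n)

theorem entries_of_bits (h : ∀ j : Fin n, f j = ((b j.succ).toNat : ℤ) - (b j.castSucc).toNat)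
    (j : Fin n) : f j = 0 ∨ f j = 1 ∨ f j = -1 := by
  rw [h]
  cases b j.succ <;> cases b j.castSucc <;> simp

/-- Zeros leave the bit unchanged, so the bit before a nonzero term is the bit after the preceding
nonzero term; two successive changes of a bit have opposite signs. -/
theorem alternates_of_bits
    (h : ∀ j : Fin n, f j = ((b j.succ).toNat : ℤ) - (b j.castSucc).toNat) : Alternates f := by
  intro j j' hjj hj hj' hz
  have key : ∀ k : Fin n, j < k → k ≤ j' → b k.castSucc = b j.succ := by
    intro ⟨k, hk⟩
    induction k with
    | zero => intro h; simp [Fin.lt_def] at h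
    | succ k ih =>
      intro h1 h2
      rcases (Nat.lt_succ_iff.1 h1 : j.val ≤ k).lt_or_eq with h3 | h3
      · have e := ih (by omega) h3 (Fin.le_def.2 (by have := Fin.le_def.1 h2; simp at this ⊢; omega))
        have e' := hz ⟨k, by omega⟩ h3 (Fin.lt_def.2 (by have := Fin.le_def.1 h2; simp at this ⊢; omega))
        rw [h] at e'
        rw [← e]
        change b (Fin.succ ⟨k, by omega⟩) = _
        generalize b (Fin.succ ⟨k, by omega⟩) = p at *
        generalize b (Fin.castSucc ⟨k, by omega⟩) = q at *
        cases p <;> cases q <;> simp_all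
      · congr 1
        ext
        simp [h3]
  have e := key j' hjj le_rfl
  rw [h] at hj hj' ⊢
  rw [h]
  rw [e] at hj' ⊢
  cases h2 : b j.succ <;> cases h3 : b j.castSucc <;> cases h4 : b j'.succ <;> simp_all

end OfBits

end PartialSums

/-! ### The partition function as a sum over ice configurations. -/

section Paths

variable {R : Type*} [CommRing R]

theorem prod_ofFn_apply {ι : Type*} [Fintype ι] [DecidableEq ι] :
    ∀ {m : ℕ} (M : Fin m → Matrix ι ι R) (s t : ι),
      (List.ofFn M).prod s t = ∑ p : Fin (m + 1) → ι,
        if p 0 = s ∧ p (Fin.last m) = t then ∏ i : Fin m, M i (p i.castSucc) (p i.succ) else 0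
  | 0, M, s, t => by
    rw [← (Equiv.funUnique (Fin 1) ι).symm.sum_comp]
    simp only [List.ofFn_zero, List.prod_nil, Matrix.one_apply, Equiv.funUnique_symm_apply,
      uniqueElim_const, Finset.univ_eq_empty, Finset.prod_empty, ite_and, Finset.sum_ite_eq',
      Finset.mem_univ, if_true]
  | m + 1, M, s, t => by
    rw [← (Fin.consEquiv fun _ => ι).sum_comp, Fintype.sum_prod_type]
    simp only [List.ofFn_succ, List.prod_cons, Matrix.mul_apply,
      prod_ofFn_apply fun i => M i.succ, Fin.consEquiv, Equiv.coe_fn_mk, Fin.cons_zero,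
      ← Fin.succ_last, Fin.cons_succ, Fin.prod_univ_succ, Fin.castSucc_zero, ite_and,
      Finset.sum_ite_irrel, Finset.sum_const_zero, Finset.sum_ite_eq', Finset.mem_univ, if_true,
      Fin.castSucc_succ, Finset.mul_sum]
    rw [Finset.sum_comm]
    refine Finset.sum_congr rfl fun p _ => ?_
    simp only [mul_ite, mul_zero, Finset.sum_ite_eq, Finset.mem_univ, if_true]

/-- The arrow configurations of the six-vertex model with domain wall boundary conditions, given by
the bits of the vertical and of the horizontal edges. -/
def iceConfigs (n : ℕ) : Finset ((Fin (n + 1) → Fin n → Bool) × (Fin n → Fin (n + 1) → Bool)) :=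
  Finset.univ.filter fun c =>
    (∀ j, c.1 0 j = false) ∧ (∀ j, c.1 (Fin.last n) j = true) ∧ (∀ i, c.2 i 0 = false) ∧
    (∀ i, c.2 i (Fin.last n) = true) ∧
    ∀ i j, ((c.1 i.succ j).toNat : ℤ) - (c.1 i.castSucc j).toNat =
      (c.2 i j.succ).toNat - (c.2 i j.castSucc).toNat

theorem vertex_eq_zero (x y v u : R) {s t r q : Bool}
    (h : ¬ (t.toNat : ℤ) - s.toNat = q.toNat - r.toNat) : vertex x y v u s t r q = 0 := by
  cases s <;> cases t <;> cases r <;> cases q <;> simp_all [vertex]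

theorem dwbc_eq_sum_iceConfigs (x y : R) {n : ℕ} (v u : Fin n → R) :
    dwbc x y v u = ∑ c ∈ iceConfigs n, ∏ i, ∏ j,
      vertex x y (v i) (u j) (c.1 i.castSucc j) (c.1 i.succ j) (c.2 i j.castSucc)
        (c.2 i j.succ) := by
  rw [dwbc, prod_ofFn_apply, iceConfigs, Finset.sum_filter, Fintype.sum_prod_type]
  refine Finset.sum_congr rfl fun p _ => ?_
  simp only [rowMatrix, Matrix.of_apply, prod_ofFn_apply, Finset.prod_univ_sum,
    Fintype.piFinset_univ]
  by_cases hp : p 0 = (fun _ => false) ∧ p (Fin.last n) = fun _ => true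
  · rw [if_pos hp]
    refine Finset.sum_congr rfl fun r _ => ?_
    have hp0 : ∀ j, p 0 j = false := congr_fun hp.1
    have hp1 : ∀ j, p (Fin.last n) j = true := congr_fun hp.2
    simp only [hp0, hp1, implies_true, true_and]
    by_cases hr : ∀ i, r i 0 = false ∧ r i (Fin.last n) = true
    · simp only [hr, and_self, if_true, implies_true, true_and]
      split_ifs with hc
      · rfl
      · push Not at hc
        obtain ⟨i, j, hij⟩ := hc
        exact Finset.prod_eq_zero (Finset.mem_univ i)
          (Finset.prod_eq_zero (Finset.mem_univ j) (vertex_eq_zero _ _ _ _ hij))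
    · rw [if_neg fun h => hr fun i => ⟨h.1 i, h.2.1 i⟩]
      push Not at hr
      obtain ⟨i, hi⟩ := hr
      exact Finset.prod_eq_zero (Finset.mem_univ i) (if_neg fun h => hi h.1 h.2)
  · rw [if_neg hp, Finset.sum_eq_zero]
    intro r _
    exact if_neg fun h => hp ⟨funext h.1, funext h.2.1⟩

end Paths

/-! ### Alternating sign matrices as ice configurations, and the statistics. -/

section Bijection

variable {n : ℕ}

/-- The ice configuration of partial column and row sums. -/
def toIce (A : Matrix (Fin n) (Fin n) ℤ) :
    (Fin (n + 1) → Fin n → Bool) × (Fin n → Fin (n + 1) → Bool) :=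
  (fun i j => partialBit (fun i' => A i' j) i, fun i j => partialBit (fun j' => A i j') j)

theorem IsASM.col_sub {A : Matrix (Fin n) (Fin n) ℤ} (hA : IsASM A) (i j : Fin n) :
    (((toIce A).1 i.succ j).toNat : ℤ) - ((toIce A).1 i.castSucc j).toNat = A i j :=
  partialBit_succ_sub (hA.alternates_col j) (fun i => hA.entries i j) (hA.sum_col j) i

theorem IsASM.row_sub {A : Matrix (Fin n) (Fin n) ℤ} (hA : IsASM A) (i j : Fin n) :
    (((toIce A).2 i j.succ).toNat : ℤ) - ((toIce A).2 i j.castSucc).toNat = A i j :=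
  partialBit_succ_sub (hA.alternates_row i) (fun j => hA.entries i j) (hA.sum_row i) j

theorem sum_iceConfigs {M : Type*} [AddCommMonoid M]
    (w : (Fin (n + 1) → Fin n → Bool) × (Fin n → Fin (n + 1) → Bool) → M) :
    ∑ c ∈ iceConfigs n, w c = ∑ A ∈ asm n, w (toIce A) := by
  symm
  refine Finset.sum_bij' (fun A _ => toIce A)
    (fun c _ => Matrix.of fun i j => ((c.1 i.succ j).toNat : ℤ) - (c.1 i.castSucc j).toNat)
    ?_ ?_ ?_ ?_ fun _ _ => rfl
  · intro A hA
    rw [mem_asm] at hA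
    simp only [iceConfigs, Finset.mem_filter, Finset.mem_univ, true_and]
    exact ⟨fun j => partialBit_zero _, fun j => partialBit_last (hA.sum_col j),
      fun i => partialBit_zero _, fun i => partialBit_last (hA.sum_row i),
      fun i j => (hA.col_sub i j).trans (hA.row_sub i j).symm⟩
  · intro c hc
    simp only [iceConfigs, Finset.mem_filter, Finset.mem_univ, true_and] at hc
    obtain ⟨h1, h2, h3, h4, h5⟩ := hc
    rw [mem_asm]
    exact
      { entries := fun i j => entries_of_bits (b := c.2 i) (h5 i) j
        alternates_row := fun i => alternates_of_bits (b := c.2 i) (h5 i)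
        alternates_col := fun j => alternates_of_bits (b := fun i => c.1 i j) fun i => rfl
        sum_row := fun i => sum_of_bits (h3 i) (h4 i) (h5 i)
        sum_col := fun j => sum_of_bits (b := fun i => c.1 i j) (h1 j) (h2 j) fun i => rfl }
  · intro A hA
    rw [mem_asm] at hA
    ext i j
    exact hA.col_sub i j
  · intro c hc
    simp only [iceConfigs, Finset.mem_filter, Finset.mem_univ, true_and] at hc
    obtain ⟨h1, h2, h3, h4, h5⟩ := hc
    refine Prod.ext ?_ ?_
    · funext i j
      exact congr_fun (partialBit_of_bits (b := fun i => c.1 i j) (h1 j) fun i => rfl) i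
    · funext i
      exact partialBit_of_bits (h3 i) (h5 i)

/-- Grouping by the lower row `i'` and the column `j` factors the sum into column partial sums above
`i'` times row partial sums through `j`, both of which are bits. -/
theorem IsASM.inv_eq_sum {A : Matrix (Fin n) (Fin n) ℤ} (hA : IsASM A) :
    inv A = ∑ i, ∑ j, (if (toIce A).1 i.castSucc j = true ∧ (toIce A).2 i j.succ = true
      then 1 else 0) := by
  unfold inv
  rw [Finset.sum_comm' (t' := Finset.univ)
    (s' := fun i' => Finset.univ.filter (fun i : Fin n => i.val < i'.val))
    (by intro a b; simp)]
  refine Finset.sum_congr rfl fun i' _ => ?_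
  rw [Finset.sum_comm]
  refine Finset.sum_congr rfl fun j _ => ?_
  have e1 := toNat_partialBit (hA.alternates_col j) (fun i => hA.entries i j) (hA.sum_col j)
    i'.castSucc
  have e2 := toNat_partialBit (hA.alternates_row i') (fun j => hA.entries i' j) (hA.sum_row i')
    j.succ
  have e3 : Finset.Iic j = Finset.univ.filter fun k : Fin n => k.val < j.succ.val := by
    ext k
    simp only [Finset.mem_Iic, Finset.mem_filter, Finset.mem_univ, true_and, Fin.le_def,
      Fin.val_succ, Nat.lt_succ_iff]
  simp_rw [← Finset.mul_sum]
  rw [← Finset.sum_mul, e3, ← e2]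
  rw [Fin.val_castSucc] at e1
  rw [← e1]
  have key : ∀ a b : Bool, (a.toNat : ℤ) * b.toNat = if a = true ∧ b = true then 1 else 0 := by
    decide
  exact key _ _

theorem IsASM.nu_eq_sum {A : Matrix (Fin n) (Fin n) ℤ} (hA : IsASM A) :
    nu A = ∑ i, ∑ j, (if (toIce A).1 i.castSucc j = true ∧ (toIce A).2 i j.succ = true
      then 1 else 0) := by
  have := natCast_nu hA
  rw [hA.inv_eq_sum] at this
  exact_mod_cast this

theorem mu_eq_sum (A : Matrix (Fin n) (Fin n) ℤ) :
    mu A = ∑ i, ∑ j, (if A i j = -1 then 1 else 0) := by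
  rw [mu, Finset.card_filter, Fintype.sum_prod_type]

theorem IsASM.rho_eq_sum [NeZero n] {A : Matrix (Fin n) (Fin n) ℤ} (hA : IsASM A) :
    rho A = ∑ j, (if A 0 j = 0 ∧ (toIce A).2 0 j.succ = false then 1 else 0) := by
  -- The first row has no -1, so a 1 lies to the right of `j` exactly when the partial sum through
  -- `j` is 0.
  have h0 : ∀ j, A 0 j = 0 ∨ A 0 j = 1 := by
    intro j
    have := hA.col_sub 0 j
    rw [show Fin.castSucc (0 : Fin n) = 0 from Fin.castSucc_zero', toIce] at this
    simp only [partialBit_zero, Bool.toNat_false] at this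
    have h2 := Bool.toNat_le (partialBit (fun i' => A i' j) (Fin.succ 0))
    omega
  rw [rho, Finset.card_filter]
  refine Finset.sum_congr rfl fun j _ => ?_
  congr 1
  rw [eq_iff_iff]
  refine and_congr_right fun _ => ?_
  have e2 := toNat_partialBit (hA.alternates_row 0) (fun j => hA.entries 0 j) (hA.sum_row 0)
    j.succ
  have e3 := Finset.sum_filter_add_sum_filter_not Finset.univ
    (fun k : Fin n => k.val < j.succ.val) (fun k => A 0 k)
  rw [hA.sum_row 0, ← e2] at e3
  constructor
  · rintro ⟨j', hj, hj'⟩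
    have : (1 : ℤ) ≤ ∑ k ∈ Finset.univ.filter (fun k : Fin n => ¬ k.val < j.succ.val), A 0 k := by
      rw [← hj']
      refine Finset.single_le_sum (f := fun k => A 0 k) (fun k _ => ?_) ?_
      · rcases h0 k with h | h <;> simp [h]
      · simp only [Finset.mem_filter, Finset.mem_univ, true_and, Fin.val_succ, not_lt]
        exact hj
    simp only [toIce]
    cases hb : partialBit (fun j' => A 0 j') j.succ
    · rfl
    · rw [hb] at e3
      simp only [Bool.toNat_true] at e3
      push_cast at e3
      omega
  · intro h
    simp only [toIce] at h
    rw [h] at e3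
    simp only [Bool.toNat_false, Nat.cast_zero, zero_add] at e3
    by_contra! hne
    rw [Finset.sum_eq_zero] at e3
    · exact zero_ne_one e3
    · intro k hk
      simp only [Finset.mem_filter, Finset.mem_univ, true_and, Fin.val_succ, not_lt] at hk
      exact (h0 k).resolve_right (hne k hk)

end Bijection

/-! ### Specialising the weights to the generating function. -/

section Homogeneous

variable {R : Type*} [CommRing R]

theorem vertex_zero_zero (x y : R) {s t r q : Bool}
    (h : (t.toNat : ℤ) - s.toNat = q.toNat - r.toNat) :
    vertex x y 0 0 s t r q = x ^ (if s = true ∧ q = true then 1 else 0) *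
      y ^ (if (t.toNat : ℤ) - s.toNat = -1 then 1 else 0) := by
  cases s <;> cases t <;> cases r <;> cases q <;> simp_all [vertex, wtA, wtB, wtC]

theorem vertex_special (x y : R) {c z : R} (hz : z * (1 - c) = 1) {t r q : Bool}
    (h : (t.toNat : ℤ) - Bool.toNat false = q.toNat - r.toNat) :
    z ^ (if t = true then 0 else 1) * vertex x y c 0 false t r q =
      z ^ (if t = false ∧ q = false then 1 else 0) := by
  cases t <;> cases r <;> cases q <;> simp_all [vertex, wtA, wtB]

/-- In the first row the zeros left of the 1 have weight 1 and those right of it weight 1 - c, the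
inverse of z. Assigning one factor z to each of the `m` zeros leaves z^ρ. -/
theorem pow_mul_dwbc (x y : R) (m : ℕ) {c z : R} (hz : z * (1 - c) = 1) :
    z ^ m * dwbc x y (Fin.cons c fun _ => 0 : Fin (m + 1) → R) (fun _ : Fin (m + 1) => 0) =
      ZASM (m + 1) x y z := by
  rw [dwbc_eq_sum_iceConfigs, sum_iceConfigs, ZASM, Finset.mul_sum]
  refine Finset.sum_congr rfl fun A hA => ?_
  rw [mem_asm] at hA
  have hcons := fun i j => (hA.col_sub i j).trans (hA.row_sub i j).symm
  have h0 : ∀ j, (toIce A).1 (Fin.castSucc 0) j = false := fun j => partialBit_zero _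
  have hA0 : ∀ j, A 0 j = ((toIce A).1 (Fin.succ 0) j).toNat := fun j => by
    rw [← hA.col_sub 0 j, h0]; simp
  have hz' : z ^ m = ∏ j, z ^ (if (toIce A).1 (Fin.succ 0) j = true then 0 else 1) := by
    rw [Finset.prod_pow_eq_pow_sum]
    congr 1
    have h1 : ∑ j, ((if (toIce A).1 (Fin.succ 0) j = true then 0 else 1 : ℕ) : ℤ) =
        ∑ j, (1 - A 0 j) := Finset.sum_congr rfl fun j _ => by
      rw [hA0]
      cases (toIce A).1 (Fin.succ 0) j <;> simp
    rw [Finset.sum_sub_distrib, hA.sum_row 0, Finset.sum_const, Finset.card_univ,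
      Fintype.card_fin] at h1
    have h2 : ((∑ j, (if (toIce A).1 (Fin.succ 0) j = true then 0 else 1) : ℕ) : ℤ) = m := by
      rw [Nat.cast_sum, h1]
      simp
    exact_mod_cast h2.symm
  rw [hA.nu_eq_sum, mu_eq_sum, hA.rho_eq_sum, hz']
  simp only [← Finset.prod_pow_eq_pow_sum]
  have row0 : ∀ j, z ^ (if (toIce A).1 (Fin.succ 0) j = true then 0 else 1) *
      vertex x y c 0 ((toIce A).1 (Fin.castSucc 0) j) ((toIce A).1 (Fin.succ 0) j)
        ((toIce A).2 0 j.castSucc) ((toIce A).2 0 j.succ) =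
      z ^ (if A 0 j = 0 ∧ (toIce A).2 0 j.succ = false then 1 else 0) := fun j => by
    have h := hcons 0 j
    rw [h0] at h ⊢
    rw [vertex_special x y hz h, hA0]
    congr 2
    cases (toIce A).1 (Fin.succ 0) j <;> simp
  have hx : ∀ j, x ^ (if (toIce A).1 (Fin.castSucc 0) j = true ∧ (toIce A).2 0 j.succ = true
      then 1 else 0) = 1 := fun j => by
    rw [h0, if_neg (by simp), pow_zero]
  have hy : ∀ j, y ^ (if A 0 j = -1 then 1 else 0) = 1 := fun j => by
    rw [if_neg, pow_zero]
    rw [hA0]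
    omega
  have rows : ∀ (i : Fin m) j, vertex x y ((Fin.cons c fun _ => 0 : Fin (m + 1) → R) i.succ) 0
      ((toIce A).1 i.succ.castSucc j) ((toIce A).1 i.succ.succ j) ((toIce A).2 i.succ j.castSucc)
        ((toIce A).2 i.succ j.succ) =
      x ^ (if (toIce A).1 i.succ.castSucc j = true ∧ (toIce A).2 i.succ j.succ = true
        then 1 else 0) * y ^ (if A i.succ j = -1 then 1 else 0) := fun i j => by
    rw [Fin.cons_succ, vertex_zero_zero x y (hcons _ _), hA.col_sub]
  rw [Fin.prod_univ_succ (fun i => ∏ j, vertex x y _ 0 _ _ _ _),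
    Fin.prod_univ_succ (fun i => ∏ j, x ^ _), Fin.prod_univ_succ (fun i => ∏ j, y ^ _),
    Finset.prod_congr rfl fun j _ => hx j, Finset.prod_congr rfl fun j _ => hy j, Fin.cons_zero,
    ← mul_assoc, ← Finset.prod_mul_distrib, Finset.prod_congr rfl fun j _ => row0 j,
    Finset.prod_congr rfl fun i _ => Finset.prod_congr rfl fun j _ => rows i j]
  simp only [Finset.prod_mul_distrib, Finset.prod_const_one, one_mul]
  ring

end Homogeneous

end RefinedASM

namespace RefinedASM

open Matrix

/-! ### Extracting staircase coefficients of multivariate power series. -/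

section Coefficients

variable {R : Type*} [CommRing R] {n : ℕ}

theorem coeff_prod_of_separated (h : Fin n → MvPowerSeries (Fin n) R)
    (hs : ∀ i e, (∃ a ≠ i, e a ≠ 0) → MvPowerSeries.coeff e (h i) = 0) (e : Fin n →₀ ℕ) :
    MvPowerSeries.coeff e (∏ i, h i) =
      ∏ i, MvPowerSeries.coeff (Finsupp.single i (e i)) (h i) := by
  rw [MvPowerSeries.coeff_prod]
  set l₀ : Fin n →₀ Fin n →₀ ℕ := Finsupp.equivFunOnFinite.symm fun i => Finsupp.single i (e i)
    with hl₀
  rw [Finset.sum_eq_single l₀]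
  · rfl
  · intro l hl hne
    by_contra hprod
    refine hne ?_
    have hz : ∀ i a, a ≠ i → l i a = 0 := by
      intro i a ha
      by_contra hc
      exact hprod (Finset.prod_eq_zero (Finset.mem_univ i) (hs i (l i) ⟨a, ha, hc⟩))
    have hsum : ∑ i, l i = e := (Finset.mem_finsuppAntidiag.1 hl).1
    ext i a
    rw [hl₀, Finsupp.coe_equivFunOnFinite_symm, Finsupp.single_apply]
    split_ifs with hia
    · subst hia
      rw [← hsum, Finsupp.finsetSum_apply, Finset.sum_eq_single i]
      · exact fun k _ hk => hz k i hk.symm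
      · simp
    · exact hz i a (Ne.symm hia)
  · intro hl
    refine absurd ?_ hl
    rw [Finset.mem_finsuppAntidiag]
    refine ⟨?_, Finset.subset_univ _⟩
    simp only [hl₀, Finsupp.coe_equivFunOnFinite_symm]
    exact Finsupp.univ_sum_single e

/-- Each column has its own variable, so in every term of the Leibniz expansion the exponents can be
distributed in only one way. -/
theorem coeff_det_of_separated (M : Matrix (Fin n) (Fin n) (MvPowerSeries (Fin n) R))
    (hs : ∀ i j e, (∃ a ≠ j, e a ≠ 0) → MvPowerSeries.coeff e (M i j) = 0) (e : Fin n →₀ ℕ) :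
    MvPowerSeries.coeff e M.det =
      (Matrix.of fun i j => MvPowerSeries.coeff (Finsupp.single j (e j)) (M i j)).det := by
  rw [det_apply, det_apply, map_sum]
  refine Finset.sum_congr rfl fun σ _ => ?_
  rw [Units.smul_def, Units.smul_def, map_zsmul,
    coeff_prod_of_separated (fun i => M (σ i) i) fun i => hs (σ i) i]
  rfl

/-- The exponent `(0, 1, …, n - 1)`. -/
noncomputable def staircase (n : ℕ) : Fin n →₀ ℕ := Finsupp.equivFunOnFinite.symm fun i => i.val

theorem perm_eq_one_of_le {σ : Equiv.Perm (Fin n)} (h : ∀ i, σ i ≤ i) : σ = 1 := by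
  have key : ∀ k : ℕ, ∀ hk : k < n, σ ⟨k, hk⟩ = ⟨k, hk⟩ := by
    intro k
    induction k using Nat.strong_induction_on with
    | _ k ih =>
      intro hk
      by_contra hne
      have hlt : σ ⟨k, hk⟩ < ⟨k, hk⟩ := lt_of_le_of_ne (h _) hne
      exact hne (σ.injective (ih (σ ⟨k, hk⟩).val hlt (σ ⟨k, hk⟩).isLt))
  ext i
  rw [key i.val i.isLt]
  rfl

theorem prod_X_pow (s : Finset (Fin n)) (d : Fin n → ℕ) :
    ∏ i ∈ s, (MvPowerSeries.X i : MvPowerSeries (Fin n) R) ^ d i =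
      MvPowerSeries.monomial (∑ i ∈ s, Finsupp.single i (d i)) 1 := by
  induction s using Finset.induction_on with
  | empty => simp
  | insert i s hi ih =>
    rw [Finset.prod_insert hi, Finset.sum_insert hi, ih, MvPowerSeries.X_pow_eq,
      MvPowerSeries.monomial_mul_monomial, one_mul]

/-- Among the monomials of the Vandermonde determinant only that of the identity permutation divides
the staircase monomial. This replaces dividing by the Vandermonde and then setting the variables to
0. -/
theorem coeff_staircase_vandermonde (S : MvPowerSeries (Fin n) R) :
    MvPowerSeries.coeff (staircase n)
      ((vandermonde fun i => (MvPowerSeries.X i : MvPowerSeries (Fin n) R)).det * S) =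
      MvPowerSeries.constantCoeff S := by
  have hmon : ∀ σ : Equiv.Perm (Fin n),
      ∏ i, (MvPowerSeries.X i : MvPowerSeries (Fin n) R) ^ (σ i).val =
        MvPowerSeries.monomial (Finsupp.equivFunOnFinite.symm fun i => (σ i).val) 1 := by
    intro σ
    rw [prod_X_pow, ← Finsupp.univ_sum_single (Finsupp.equivFunOnFinite.symm fun i => (σ i).val)]
    rfl
  rw [← det_transpose, det_apply, Finset.sum_mul, map_sum, Finset.sum_eq_single 1]
  · simp only [Equiv.Perm.sign_one, one_smul, Equiv.Perm.one_apply, transpose_apply,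
      vandermonde_apply]
    have := hmon 1
    simp only [Equiv.Perm.one_apply] at this
    rw [this, MvPowerSeries.coeff_monomial_mul, staircase, if_pos le_rfl, one_mul, tsub_self,
      MvPowerSeries.coeff_zero_eq_constantCoeff_apply]
  · intro σ _ hσ
    simp only [transpose_apply, vandermonde_apply]
    rw [hmon, Units.smul_def, smul_mul_assoc, map_zsmul, MvPowerSeries.coeff_monomial_mul, if_neg,
      smul_zero]
    exact fun hle => hσ (perm_eq_one_of_le fun i => hle i)
  · simp

/-- A power series in one variable, as a power series in the `j`-th variable. -/
noncomputable def inVar (j : Fin n) : PowerSeries R →ₐ[R] MvPowerSeries (Fin n) R :=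
  MvPowerSeries.rename fun _ : Unit => j

theorem inVar_X (j : Fin n) : inVar j (PowerSeries.X : PowerSeries R) = MvPowerSeries.X j :=
  MvPowerSeries.rename_X _ _

theorem inVar_C (j : Fin n) (a : R) : inVar j (PowerSeries.C a) = MvPowerSeries.C a :=
  MvPowerSeries.rename_C _ _

theorem constantCoeff_inVar (j : Fin n) (f : PowerSeries R) :
    MvPowerSeries.constantCoeff (inVar j f) = PowerSeries.constantCoeff f :=
  MvPowerSeries.constantCoeff_rename _ _

theorem coeff_single_inVar (j : Fin n) (f : PowerSeries R) (k : ℕ) :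
    MvPowerSeries.coeff (Finsupp.single j k) (inVar j f) = PowerSeries.coeff k f := by
  have := MvPowerSeries.coeff_embDomain_rename (R := R) (⟨fun _ => j, fun _ _ _ => rfl⟩ : Unit ↪ Fin n)
    f (Finsupp.single () k)
  rw [Finsupp.embDomain_single] at this
  exact this

theorem coeff_inVar_eq_zero (j : Fin n) (f : PowerSeries R) (e : Fin n →₀ ℕ)
    (h : ∃ a ≠ j, e a ≠ 0) : MvPowerSeries.coeff e (inVar j f) = 0 := by
  refine MvPowerSeries.coeff_rename_eq_zero _ _ ?_
  rintro ⟨d, rfl⟩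
  obtain ⟨a, ha, h0⟩ := h
  exact h0 (Finsupp.mapDomain_of_notMem_range _ _ (by rintro ⟨_, rfl⟩; exact ha rfl))

end Coefficients

/-! ### All column parameters set to 0. -/

section ColumnLimit

variable {R : Type*} [CommRing R]

theorem mk_pow_mul (a : R) :
    (PowerSeries.mk fun k => a ^ k) * (1 - PowerSeries.X * PowerSeries.C a) = 1 := by
  ext k
  cases k with
  | zero => simp
  | succ k =>
    rw [mul_sub, mul_one, map_sub, ← mul_assoc, PowerSeries.coeff_mul_C,
      PowerSeries.coeff_succ_mul_X]
    simp [pow_succ, PowerSeries.coeff_one]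

/-- The inverse of `wtA v`. -/
noncomputable def invA (v : R) : PowerSeries R := PowerSeries.mk fun k => v ^ k

/-- The inverse of `wtB x y v`, where `t` is the inverse of `1 - v`. -/
noncomputable def invB (x y v t : R) : PowerSeries R :=
  PowerSeries.mk fun k => (y * (1 - v) + x * v) ^ k * t ^ (k + 1)

theorem invA_mul (v : R) : invA v * wtA (PowerSeries.C v) PowerSeries.X = 1 := mk_pow_mul v

theorem invB_mul (x y v t : R) (ht : t * (1 - v) = 1) :
    invB x y v t * wtB (PowerSeries.C x) (PowerSeries.C y) (PowerSeries.C v) PowerSeries.X = 1 := by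
  have h1 : invB x y v t =
      PowerSeries.C t * PowerSeries.mk fun k => ((y * (1 - v) + x * v) * t) ^ k := by
    ext k
    simp only [invB, PowerSeries.coeff_mk, PowerSeries.coeff_C_mul, mul_pow]
    ring
  have h2 : wtB (PowerSeries.C x) (PowerSeries.C y) (PowerSeries.C v) PowerSeries.X =
      PowerSeries.C (1 - v) *
        (1 - PowerSeries.X * PowerSeries.C ((y * (1 - v) + x * v) * t)) := by
    have ht' := congrArg (PowerSeries.C (R := R)) ht
    simp only [map_mul, map_sub, map_one, map_add, wtB] at ht' ⊢
    linear_combination (PowerSeries.X * (PowerSeries.C y * (1 - PowerSeries.C v) +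
      PowerSeries.C x * PowerSeries.C v)) * ht'
  rw [h1, h2, mul_mul_mul_comm, ← map_mul, mk_pow_mul, ht, map_one, mul_one]

theorem dwbc_mul_vandermonde_zero (x y w : R) (hw : y * w ^ 2 + (1 - x - y) * w + x = 0) {n : ℕ}
    (v t : Fin n → R) (ht : ∀ i, t i * (1 - v i) = 1) :
    dwbc x y v (fun _ : Fin n => 0) * (vandermonde v).det * (∏ i, (1 - (1 - w) * v i)) *
        ∏ i, t i ^ n =
      (Matrix.of fun i j : Fin n => (1 - w) * v i ^ j.val +
        w * ((y * (1 - v i) + x * v i) ^ j.val * t i ^ (j.val + 1))).det := by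
  let D := MvPowerSeries (Fin n) R
  let c : R →+* D := MvPowerSeries.C
  let X : Fin n → D := MvPowerSeries.X
  let a : Fin n → Fin n → D := fun i j => inVar j (invA (v i))
  let b : Fin n → Fin n → D := fun i j => inVar j (invB x y (v i) (t i))
  have ha : ∀ i j, a i j * wtA (c (v i)) (X j) = 1 := fun i j => by
    have := congrArg (inVar j) (invA_mul (v i))
    simpa only [map_mul, map_one, wtA, map_sub, inVar_X, inVar_C] using this
  have hb : ∀ i j, b i j * wtB (c x) (c y) (c (v i)) (X j) = 1 := fun i j => by
    have := congrArg (inVar j) (invB_mul x y (v i) (t i) (ht i))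
    simpa only [map_mul, map_one, wtB, map_sub, inVar_X, inVar_C] using this
  let H : Matrix (Fin n) (Fin n) D := Matrix.of fun i j => (1 - c w) * a i j + c w * b i j
  have hwc : c y * c w ^ 2 + (1 - c x - c y) * c w + c x = 0 := by
    have := congrArg c hw
    simpa only [map_add, map_mul, map_pow, map_sub, map_one, map_zero] using this
  have hH : ∀ i j, H i j = (1 - (1 - c w) * c (v i)) *
      ((1 - (1 - c w) * c y * X j) * (∏ m, a m j * b m j) *
        ikMatrix (c x) (c y) (fun i => c (v i)) X i j) := by
    intro i j
    have e1 : (∏ m, a m j * b m j) * ikMatrix (c x) (c y) (fun i => c (v i)) X i j =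
        a i j * b i j := by
      simp only [ikMatrix, Matrix.of_apply]
      rw [← Finset.prod_mul_distrib, Finset.prod_eq_single i]
      · simp
      · intro m _ hm
        rw [if_neg hm]
        linear_combination b m j * wtB (c x) (c y) (c (v m)) (X j) * ha m j + hb m j
      · simp
    rw [mul_assoc _ (∏ m, a m j * b m j), e1]
    have hA := ha i j
    have hB := hb i j
    simp only [H, Matrix.of_apply]
    -- The one use of the quadratic equation: it makes this combination split into a function of the
    -- row times a function of the column.
    have e2 : (1 - c w) * wtB (c x) (c y) (c (v i)) (X j) + c w * wtA (c (v i)) (X j) =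
        (1 - (1 - c w) * c (v i)) * (1 - (1 - c w) * c y * X j) := by
      simp only [wtA, wtB]
      linear_combination (- X j * c (v i)) * hwc
    calc _ = a i j * b i j * ((1 - c w) * wtB (c x) (c y) (c (v i)) (X j) +
          c w * wtA (c (v i)) (X j)) := by
            linear_combination (-(1 - c w) * a i j) * hB + (-c w * b i j) * hA
      _ = _ := by rw [e2]; ring
  have hdet : H.det = (vandermonde X).det * (dwbc (c x) (c y) (fun i => c (v i)) X *
      (vandermonde fun i => c (v i)).det * (∏ i, (1 - (1 - c w) * c (v i))) *
      ∏ j, ((1 - (1 - c w) * c y * X j) * ∏ m, a m j * b m j)) := by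
    have : H = Matrix.of fun i j => (1 - (1 - c w) * c (v i)) *
        (Matrix.of fun i j => ((1 - (1 - c w) * c y * X j) * ∏ m, a m j * b m j) *
          ikMatrix (c x) (c y) (fun i => c (v i)) X i j) i j := by
      ext1 i j
      exact hH i j
    rw [this, det_mul_column, det_mul_row, ← dwbc_mul_vandermonde]
    ring
  have hcoeff := congrArg (MvPowerSeries.coeff (staircase n)) hdet
  rw [coeff_staircase_vandermonde, coeff_det_of_separated] at hcoeff
  · have hX : ∀ j, MvPowerSeries.constantCoeff (X j) = 0 := MvPowerSeries.constantCoeff_X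
    have hC : ∀ r, MvPowerSeries.constantCoeff (c r) = r := fun r => MvPowerSeries.constantCoeff_C r
    have ha0 : ∀ i j, MvPowerSeries.constantCoeff (a i j) = 1 := fun i j => by
      simp [a, constantCoeff_inVar, invA]
    have hb0 : ∀ i j, MvPowerSeries.constantCoeff (b i j) = t i := fun i j => by
      simp [b, constantCoeff_inVar, invB]
    simp only [map_mul, map_prod, map_sub, map_one, map_dwbc, map_det_vandermonde, hX, hC, ha0, hb0,
      mul_zero, sub_zero, one_mul, Finset.prod_const, Finset.card_univ, Fintype.card_fin] at hcoeff
    rw [Finset.prod_pow, ← hcoeff]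
    congr 1
    ext i j
    simp only [Matrix.of_apply, H, a, b, c]
    rw [map_add, ← map_one (MvPowerSeries.C (σ := Fin n) (R := R)), ← map_sub,
      MvPowerSeries.coeff_C_mul, MvPowerSeries.coeff_C_mul, staircase,
      Finsupp.coe_equivFunOnFinite_symm, coeff_single_inVar, coeff_single_inVar, invA, invB,
      PowerSeries.coeff_mk, PowerSeries.coeff_mk]
  · intro i j e he
    simp only [Matrix.of_apply, H, a, b, c]
    rw [map_add, ← map_one (MvPowerSeries.C (σ := Fin n) (R := R)), ← map_sub,
      MvPowerSeries.coeff_C_mul, MvPowerSeries.coeff_C_mul, coeff_inVar_eq_zero _ _ _ he,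
      coeff_inVar_eq_zero _ _ _ he, mul_zero, mul_zero, add_zero]

end ColumnLimit

end RefinedASM

namespace RefinedASM

open Matrix

/-! ### All row parameters but the first set to 0. -/

section RowLimit

variable {R : Type*} [CommRing R]

/-- The entries of `MASM` outside of the last column. -/
def entry (x y w : R) (i j : ℕ) : R :=
  (1 - w) * (if i = j then 1 else 0) + w * ∑ k ∈ Finset.range (min i j + 1),
    (i.choose k : R) * (j.choose k : R) * x ^ k * y ^ (i - k)

theorem coeff_X_pow_mul_mk_one_pow (l j : ℕ) :
    PowerSeries.coeff j (PowerSeries.X ^ l * PowerSeries.mk 1 ^ (l + 1) : PowerSeries R) =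
      j.choose l := by
  rw [PowerSeries.mk_one_pow_eq_mk_choose_add, PowerSeries.coeff_X_pow_mul']
  split_ifs with h
  · rw [PowerSeries.coeff_mk, Nat.add_sub_cancel' h]
  · rw [Nat.choose_eq_zero_of_lt (not_le.1 h), Nat.cast_zero]

theorem coeff_eq_entry (x y w : R) (i j : ℕ) :
    PowerSeries.coeff j (PowerSeries.C (1 - w) * PowerSeries.X ^ i + PowerSeries.C w *
      ((PowerSeries.C y * (1 - PowerSeries.X) + PowerSeries.C x * PowerSeries.X) ^ i *
        (PowerSeries.mk 1) ^ (i + 1))) = entry x y w i j := by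
  have h1 : ((PowerSeries.C y * (1 - PowerSeries.X) + PowerSeries.C x * PowerSeries.X) ^ i *
        (PowerSeries.mk 1) ^ (i + 1) : PowerSeries R) =
      ∑ k ∈ Finset.range (i + 1), PowerSeries.C ((i.choose k : R) * x ^ k * y ^ (i - k)) *
        (PowerSeries.X ^ k * (PowerSeries.mk 1) ^ (k + 1)) := by
    -- In the binomial expansion the powers of `1 - X` cancel against the geometric series, leaving
    -- `k + 1` factors of the latter.
    rw [add_comm, add_pow, Finset.sum_mul]
    refine Finset.sum_congr rfl fun k hk => ?_
    have hk' : i + 1 = (i - k) + (k + 1) := by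
      have := Finset.mem_range.1 hk
      omega
    have hg := congrArg (· ^ (i - k)) (PowerSeries.mk_one_mul_one_sub_eq_one R)
    simp only [mul_pow, one_pow] at hg
    rw [hk', pow_add _ (i - k)]
    simp only [map_mul, map_pow, map_natCast, mul_pow]
    linear_combination (PowerSeries.C x ^ k * PowerSeries.X ^ k * PowerSeries.C y ^ (i - k) *
      (PowerSeries.mk 1) ^ (k + 1) * (i.choose k : PowerSeries R)) * hg
  rw [h1, map_add, PowerSeries.coeff_C_mul, PowerSeries.coeff_C_mul, PowerSeries.coeff_X_pow,
    map_sum, entry]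
  congr 1
  · simp only [eq_comm]
  · congr 1
    rw [← Finset.sum_subset (Finset.range_mono (by omega : min i j + 1 ≤ i + 1))]
    · refine Finset.sum_congr rfl fun k _ => ?_
      rw [PowerSeries.coeff_C_mul, coeff_X_pow_mul_mk_one_pow]
      ring
    · intro k hk hk'
      rw [Finset.mem_range] at hk hk'
      rw [PowerSeries.coeff_C_mul, coeff_X_pow_mul_mk_one_pow,
        Nat.choose_eq_zero_of_lt (by omega : j < k), Nat.cast_zero, mul_zero]

/-- Rows other than the first get indeterminate parameters. Their Vandermonde is removed by a
staircase coefficient; the differences with the first parameter c survive as (-c)^m. -/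
theorem dwbc_special (x y w : R) (hw : y * w ^ 2 + (1 - x - y) * w + x = 0) {c z : R}
    (hz : z * (1 - c) = 1) (m : ℕ) :
    dwbc x y (Fin.cons c fun _ => 0 : Fin (m + 1) → R) (fun _ : Fin (m + 1) => 0) * (-c) ^ m *
        (1 - (1 - w) * c) * z ^ (m + 1) =
      (Matrix.of (Fin.cons
        (fun j => (1 - w) * c ^ j.val + w * ((y * (1 - c) + x * c) ^ j.val * z ^ (j.val + 1)))
        fun i j => entry x y w j.val i.val : Fin (m + 1) → Fin (m + 1) → R)).det := by
  let D := MvPowerSeries (Fin m) R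
  let C : R →+* D := MvPowerSeries.C
  let v : Fin (m + 1) → D := Fin.cons (C c) MvPowerSeries.X
  let t : Fin (m + 1) → D := Fin.cons (C z) fun i => inVar i (PowerSeries.mk 1)
  have ht : ∀ i, t i * (1 - v i) = 1 := fun i => by
    refine Fin.cases ?_ (fun i => ?_) i
    · have := congrArg C hz
      rw [map_mul, map_sub, map_one] at this
      exact this
    · have := congrArg (inVar i) (PowerSeries.mk_one_mul_one_sub_eq_one R)
      rw [map_mul, map_sub, map_one, inVar_X] at this
      exact this
  have hwc : C y * C w ^ 2 + (1 - C x - C y) * C w + C x = 0 := by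
    have := congrArg C hw
    simpa only [map_add, map_mul, map_pow, map_sub, map_one, map_zero] using this
  have h := congrArg (MvPowerSeries.coeff (staircase m))
    (dwbc_mul_vandermonde_zero (C x) (C y) (C w) hwc v t ht)
  have hrow : ∀ (i : Fin m) (j : Fin (m + 1)), (1 - C w) * v i.succ ^ j.val +
        C w * ((C y * (1 - v i.succ) + C x * v i.succ) ^ j.val * t i.succ ^ (j.val + 1)) =
      inVar i (PowerSeries.C (1 - w) * PowerSeries.X ^ j.val + PowerSeries.C w *
      ((PowerSeries.C y * (1 - PowerSeries.X) + PowerSeries.C x * PowerSeries.X) ^ j.val *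
        (PowerSeries.mk 1) ^ (j.val + 1))) := fun i j => by
    simp only [map_add, map_mul, map_pow, map_sub, map_one, inVar_X, inVar_C, v, t, Fin.cons_succ, C]
  have hrow0 : ∀ j : Fin (m + 1), (1 - C w) * v 0 ^ j.val +
        C w * ((C y * (1 - v 0) + C x * v 0) ^ j.val * t 0 ^ (j.val + 1)) =
      C ((1 - w) * c ^ j.val + w * ((y * (1 - c) + x * c) ^ j.val * z ^ (j.val + 1))) := fun j => by
    simp only [map_add, map_mul, map_pow, map_sub, map_one, v, t, Fin.cons_zero]
  have hl : dwbc (C x) (C y) v (fun _ : Fin (m + 1) => 0) * (vandermonde v).det *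
        (∏ i, (1 - (1 - C w) * v i)) * ∏ i, t i ^ (m + 1) =
      (vandermonde fun i => (MvPowerSeries.X i : D)).det *
        (dwbc (C x) (C y) v (fun _ : Fin (m + 1) => 0) * (∏ i : Fin m, (v i.succ - v 0)) *
          (∏ i, (1 - (1 - C w) * v i)) * ∏ i, t i ^ (m + 1)) := by
    rw [det_vandermonde_succ]
    simp only [v, Fin.cons_succ]
    ring
  rw [hl, coeff_staircase_vandermonde] at h
  have hC : ∀ r, MvPowerSeries.constantCoeff (C r) = r := fun r => MvPowerSeries.constantCoeff_C r
  have hv : (fun i => MvPowerSeries.constantCoeff (v i)) =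
      (Fin.cons c fun _ => 0 : Fin (m + 1) → R) := by
    ext i
    refine Fin.cases (hC c) (fun i => ?_) i
    exact MvPowerSeries.constantCoeff_X i
  have hv' : ∀ i, MvPowerSeries.constantCoeff (v i) =
      (Fin.cons c fun _ => 0 : Fin (m + 1) → R) i := congr_fun hv
  have ht0 : MvPowerSeries.constantCoeff (t 0) = z := hC z
  have ht1 : ∀ i : Fin m, MvPowerSeries.constantCoeff (t i.succ) = 1 := fun i => by
    simp [t, constantCoeff_inVar]
  have e1 : MvPowerSeries.constantCoeff (dwbc (C x) (C y) v (fun _ : Fin (m + 1) => 0) *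
      (∏ i : Fin m, (v i.succ - v 0)) * (∏ i, (1 - (1 - C w) * v i)) * ∏ i, t i ^ (m + 1)) =
      dwbc x y (Fin.cons c fun _ => 0 : Fin (m + 1) → R) (fun _ : Fin (m + 1) => 0) * (-c) ^ m *
        (1 - (1 - w) * c) * z ^ (m + 1) := by
    rw [map_mul, map_mul, map_mul, map_dwbc, hv, map_prod, map_prod, map_prod, Fin.prod_univ_succ,
      Fin.prod_univ_succ]
    simp [hv', hC, ht0, ht1]
  rw [e1] at h
  -- The first row is free of the `m` variables; expanding along it leaves `m × m` minors with one
  -- variable per row, hence the transpositions below.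
  rw [h, det_succ_row_zero, det_succ_row_zero, map_sum]
  refine Finset.sum_congr rfl fun j _ => ?_
  have e2 : ((-1) ^ (j : ℕ) : D) = C ((-1) ^ (j : ℕ)) := by
    rw [map_pow, map_neg, map_one]
  rw [Matrix.of_apply, hrow0, e2, ← map_mul, MvPowerSeries.coeff_C_mul, ← det_transpose,
    coeff_det_of_separated, ← det_transpose]
  · rw [Matrix.of_apply, Fin.cons_zero]
    congr 2
    ext a b
    simp only [Matrix.transpose_apply, Matrix.of_apply, Matrix.submatrix_apply, Fin.cons_succ,
      hrow, coeff_single_inVar, staircase, Finsupp.coe_equivFunOnFinite_symm, coeff_eq_entry]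
  · intro a b e he
    simp only [Matrix.transpose_apply, Matrix.of_apply, Matrix.submatrix_apply, hrow]
    exact coeff_inVar_eq_zero _ _ _ he

end RowLimit

/-! ### Recovering the last column. -/

section LastColumn

variable {R : Type*} [CommRing R]

/-- Uses c z = z - 1 and Pascal's rule. The term `a = l` is split off because there the natural
subtraction can truncate; its binomial coefficient is 1 regardless. -/
theorem choose_sum_step (c z : R) (hz : z * (1 - c) = 1) {l m : ℕ} (h : l ≤ m) :
    ∑ a ∈ Finset.range (l + 1), ((m + 1 - a - 2).choose (l - a) : R) * z ^ (a + 1) =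
      m.choose l + c * ∑ a ∈ Finset.range (l + 1),
        ((m + 2 - a - 2).choose (l - a) : R) * z ^ (a + 1) := by
  have h1 : c * ∑ a ∈ Finset.range (l + 1), ((m + 2 - a - 2).choose (l - a) : R) * z ^ (a + 1) =
      ∑ a ∈ Finset.range (l + 1), ((m + 2 - a - 2).choose (l - a) : R) * z ^ (a + 1) -
      ∑ a ∈ Finset.range (l + 1), ((m + 2 - a - 2).choose (l - a) : R) * z ^ a := by
    rw [Finset.mul_sum, ← Finset.sum_sub_distrib]
    refine Finset.sum_congr rfl fun a _ => ?_
    linear_combination (-((m + 2 - a - 2).choose (l - a) : R) * z ^ a) * hz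
  rw [h1, Finset.sum_range_succ' (fun a => ((m + 2 - a - 2).choose (l - a) : R) * z ^ a),
    Finset.sum_range_succ, Finset.sum_range_succ]
  have h2 : ∑ a ∈ Finset.range l, ((m + 1 - a - 2).choose (l - a) : R) * z ^ (a + 1) =
      ∑ a ∈ Finset.range l, ((m + 2 - a - 2).choose (l - a) : R) * z ^ (a + 1) -
      ∑ a ∈ Finset.range l, ((m + 2 - (a + 1) - 2).choose (l - (a + 1)) : R) * z ^ (a + 1) := by
    rw [← Finset.sum_sub_distrib]
    refine Finset.sum_congr rfl fun a ha => ?_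
    have ha' := Finset.mem_range.1 ha
    have e1 : m + 2 - a - 2 = (m + 1 - a - 2) + 1 := by omega
    have e2 : l - a = (l - (a + 1)) + 1 := by omega
    have e3 : m + 2 - (a + 1) - 2 = m + 1 - a - 2 := by omega
    rw [e1, e2, e3, Nat.choose_succ_succ]
    push_cast
    ring
  rw [h2]
  simp
  ring

/-- Formally Σ_j C(j,l) c^j = c^l/(1-c)^(l+1) = z(z-1)^l; this is the series cut at `m`, with its
tail as c^m times a polynomial in z. That polynomial is the source of the last column. -/
theorem choose_sum_identity (c z : R) (hz : z * (1 - c) = 1) (l m : ℕ) (h : l ≤ m) :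
    z * (z - 1) ^ l = ∑ j ∈ Finset.range m, (j.choose l : R) * c ^ j +
      c ^ m * ∑ a ∈ Finset.range (l + 1), ((m + 1 - a - 2).choose (l - a) : R) * z ^ (a + 1) := by
  induction m, h using Nat.le_induction with
  | base =>
    have hz' : z - 1 = z * c := by linear_combination hz
    rw [Finset.sum_eq_zero, Finset.sum_range_succ, Finset.sum_eq_zero, hz', mul_pow]
    · simp
      ring
    · intro a ha
      have := Finset.mem_range.1 ha
      rw [Nat.choose_eq_zero_of_lt (by omega), Nat.cast_zero, zero_mul]
    · intro j hj
      rw [Nat.choose_eq_zero_of_lt (Finset.mem_range.1 hj), Nat.cast_zero, zero_mul]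
  | succ m hm ih =>
    rw [ih, choose_sum_step c z hz hm,
      Finset.sum_range_succ (fun j => (j.choose l : R) * c ^ j)]
    ring

/-- The entries of the last column of `MASM`. -/
def lastEntry (x y z w : R) (n i : ℕ) : R :=
  (1 - w) * (if i + 1 = n then 1 else 0) + w * ∑ k ∈ Finset.range (i + 1),
    ∑ l ∈ Finset.range (k + 1), (i.choose k : R) * ((n - l - 2).choose (k - l) : R) *
      x ^ k * y ^ (i - k) * z ^ (l + 1)

theorem sum_entry_add_lastEntry (x y w : R) {c z : R} (hz : z * (1 - c) = 1) {k m : ℕ}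
    (h : k ≤ m) :
    (1 - w) * c ^ k + w * ((y * (1 - c) + x * c) ^ k * z ^ (k + 1)) =
      ∑ i ∈ Finset.range m, c ^ i * entry x y w k i + c ^ m * lastEntry x y z w (m + 1) k := by
  have h1 : (y * (1 - c) + x * c) ^ k * z ^ (k + 1) =
      ∑ l ∈ Finset.range (k + 1), (k.choose l : R) * x ^ l * y ^ (k - l) * (z * (z - 1) ^ l) := by
    have e : (y * (1 - c) + x * c) * z = x * (z - 1) + y := by linear_combination (y - x) * hz
    rw [pow_succ, ← mul_assoc, ← mul_pow, e, add_pow, Finset.sum_mul]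
    refine Finset.sum_congr rfl fun l _ => ?_
    rw [mul_pow]
    ring
  have h2 : ∑ i ∈ Finset.range m, c ^ i * entry x y w k i =
      (1 - w) * (if k < m then c ^ k else 0) + w * ∑ l ∈ Finset.range (k + 1),
        (k.choose l : R) * x ^ l * y ^ (k - l) * ∑ j ∈ Finset.range m, (j.choose l : R) * c ^ j := by
    simp only [entry, mul_add, Finset.sum_add_distrib]
    congr 1
    · simp [mul_comm]
    · simp only [Finset.mul_sum]
      rw [Finset.sum_comm]
      refine Finset.sum_congr rfl fun i _ => ?_
      rw [← Finset.sum_subset (Finset.range_mono (by omega : min k i + 1 ≤ k + 1))]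
      · exact Finset.sum_congr rfl fun l _ => by ring
      · intro l hl hl'
        rw [Finset.mem_range] at hl hl'
        rw [Nat.choose_eq_zero_of_lt (by omega : i < l)]
        simp
  have h3 : lastEntry x y z w (m + 1) k = (1 - w) * (if k = m then 1 else 0) +
      w * ∑ l ∈ Finset.range (k + 1), (k.choose l : R) * x ^ l * y ^ (k - l) *
        ∑ a ∈ Finset.range (l + 1), ((m + 1 - a - 2).choose (l - a) : R) * z ^ (a + 1) := by
    simp only [lastEntry, Nat.add_right_cancel_iff, Finset.mul_sum]
    congr 1
    exact Finset.sum_congr rfl fun l _ => Finset.sum_congr rfl fun a _ => by ring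
  have h4 : c ^ k = (if k < m then c ^ k else 0) + c ^ m * (if k = m then 1 else 0) := by
    rcases h.lt_or_eq with h | h
    · simp [h, h.ne]
    · simp [h]
  have h5 : ∑ l ∈ Finset.range (k + 1), (k.choose l : R) * x ^ l * y ^ (k - l) * (z * (z - 1) ^ l) =
      ∑ l ∈ Finset.range (k + 1), (k.choose l : R) * x ^ l * y ^ (k - l) *
        (∑ j ∈ Finset.range m, (j.choose l : R) * c ^ j) +
      c ^ m * ∑ l ∈ Finset.range (k + 1), (k.choose l : R) * x ^ l * y ^ (k - l) *
        ∑ a ∈ Finset.range (l + 1), ((m + 1 - a - 2).choose (l - a) : R) * z ^ (a + 1) := by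
    rw [Finset.mul_sum, ← Finset.sum_add_distrib]
    refine Finset.sum_congr rfl fun l hl => ?_
    rw [choose_sum_identity c z hz l m (by have := Finset.mem_range.1 hl; omega)]
    ring
  rw [h1, h2, h3, h5]
  linear_combination (1 - w) * h4

theorem MASM_apply_castSucc (x y z w : R) (m : ℕ) (i : Fin (m + 1)) (j : Fin m) :
    MASM (m + 1) x y z w i j.castSucc = entry x y w i j := by
  have : ¬ j.castSucc.val + 1 = m + 1 := by
    have := j.isLt
    simp only [Fin.val_castSucc]
    omega
  rw [MASM, Matrix.of_apply, if_neg this]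
  simp only [entry, Fin.ext_iff, Fin.val_castSucc]

theorem MASM_apply_last (x y z w : R) (m : ℕ) (i : Fin (m + 1)) :
    MASM (m + 1) x y z w i (Fin.last m) = lastEntry x y z w (m + 1) i := by
  simp only [MASM, Matrix.of_apply, lastEntry, Fin.ext_iff, Fin.val_last, if_true,
    Nat.add_right_cancel_iff]

/-- By `sum_entry_add_lastEntry` the first row is c^m times the last column of `MASM` plus multiples
of the other rows. Cycling that row to the last place accounts for the sign (-1)^m. -/
theorem det_special_row (x y w : R) {c z : R} (hz : z * (1 - c) = 1) (m : ℕ) :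
    (Matrix.of (Fin.cons
        (fun j => (1 - w) * c ^ j.val + w * ((y * (1 - c) + x * c) ^ j.val * z ^ (j.val + 1)))
        fun i j => entry x y w j.val i.val : Fin (m + 1) → Fin (m + 1) → R)).det =
      (-c) ^ m * (MASM (m + 1) x y z w).det := by
  set B : Matrix (Fin (m + 1)) (Fin (m + 1)) R :=
    Matrix.of (Fin.cons (fun j => lastEntry x y z w (m + 1) j.val)
      fun i j => entry x y w j.val i.val : Fin (m + 1) → Fin (m + 1) → R) with hB
  have h1 : (Matrix.of (Fin.cons
        (fun j => (1 - w) * c ^ j.val + w * ((y * (1 - c) + x * c) ^ j.val * z ^ (j.val + 1)))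
        fun i j => entry x y w j.val i.val : Fin (m + 1) → Fin (m + 1) → R)) =
      B.updateRow 0 (∑ k, (Fin.cons (c ^ m) (fun i => c ^ i.val) : Fin (m + 1) → R) k • B k) := by
    ext i j
    refine Fin.cases ?_ (fun i => ?_) i
    · rw [Matrix.updateRow_self, Fin.sum_univ_succ, Matrix.of_apply, Fin.cons_zero,
        sum_entry_add_lastEntry x y w hz (Nat.lt_succ_iff.1 j.isLt), Finset.sum_range]
      simp [hB, Finset.sum_apply, add_comm]
    · rw [Matrix.updateRow_ne (Fin.succ_ne_zero i)]
      simp [hB]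
  have h2 : (MASM (m + 1) x y z w) = (B.submatrix (finRotate (m + 1)) id)ᵀ := by
    ext i j
    rw [Matrix.transpose_apply, Matrix.submatrix_apply]
    refine Fin.lastCases ?_ (fun j => ?_) j
    · rw [finRotate_last, MASM_apply_last]
      simp [hB]
    · have : finRotate (m + 1) j.castSucc = j.succ := by
        rw [finRotate_apply, Fin.coeSucc_eq_succ]
      rw [this, MASM_apply_castSucc]
      simp [hB]
  rw [h1, det_updateRow_sum, h2, det_transpose, det_permute, sign_finRotate, Fin.cons_zero,
    smul_eq_mul, neg_pow c m]
  have : ((-1 : R) ^ m) * (-1) ^ m = 1 := by rw [← mul_pow]; simp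
  push_cast
  linear_combination (- c ^ m * B.det) * this

end LastColumn

/-! ### From regular c to arbitrary parameters. -/

section Transfer

theorem mul_ZASM_of_regular {R : Type*} [CommRing R] (m : ℕ) (x y w : R) {c z : R}
    (hw : y * w ^ 2 + (1 - x - y) * w + x = 0) (hz : z * (1 - c) = 1) (hc : IsRegular c) :
    (1 + w * (z - 1)) * ZASM (m + 1) x y z = (MASM (m + 1) x y z w).det := by
  have h := dwbc_special x y w hw hz m
  rw [det_special_row x y w hz m] at h
  have hreg : IsRegular ((-c) ^ m) := by
    have : IsRegular (-c) := by
      rw [neg_eq_neg_one_mul]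
      exact (isUnit_one.neg.isRegular).mul hc
    exact this.pow m
  apply hreg.left
  dsimp only
  rw [← h, ← pow_mul_dwbc x y m hz]
  -- The prefactor arises as z(1 - (1-ω)c) = 1 + ω(z-1).
  linear_combination (dwbc x y (Fin.cons c fun _ => 0 : Fin (m + 1) → R)
    (fun _ : Fin (m + 1) => 0) * (-c) ^ m * z ^ m * (w - 1)) * hz

variable {R S : Type*} [CommRing R] [CommRing S]

theorem map_ZASM (f : R →+* S) (m : ℕ) (x y z : R) :
    f (ZASM (m + 1) x y z) = ZASM (m + 1) (f x) (f y) (f z) := by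
  simp [ZASM]

theorem map_det_MASM (f : R →+* S) (n : ℕ) (x y z w : R) :
    f (MASM n x y z w).det = (MASM n (f x) (f y) (f z) (f w)).det := by
  rw [RingHom.map_det]
  congr 1
  ext i j
  simp only [MASM, RingHom.mapMatrix_apply, Matrix.map_apply, Matrix.of_apply]
  split_ifs <;> simp

theorem mul_ZASM_field {K : Type*} [Field K] (m : ℕ) (x y z w : K)
    (hw : y * w ^ 2 + (1 - x - y) * w + x = 0) (hz0 : z ≠ 0) (hz1 : z ≠ 1) :
    (1 + w * (z - 1)) * ZASM (m + 1) x y z = (MASM (m + 1) x y z w).det := by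
  refine mul_ZASM_of_regular m x y w (c := 1 - z⁻¹) hw (by field_simp; ring) ?_
  refine IsUnit.isRegular (Ne.isUnit ?_)
  rw [sub_ne_zero]
  intro h
  exact hz1 (inv_eq_one.1 h.symm)

/-- The equation is linear in x, with solution ω(1 + y(ω-1))/(ω-1). The universal solution thus
lives in ℤ[y,z,ω] with ω - 1 inverted, a domain in which z is neither 0 nor 1, so that the field
case applies. -/
theorem mul_ZASM (m : ℕ) (x y z w : R) (hw : y * w ^ 2 + (1 - x - y) * w + x = 0) :
    (1 + w * (z - 1)) * ZASM (m + 1) x y z = (MASM (m + 1) x y z w).det := by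
  let P := MvPolynomial (Fin 3) ℤ
  let Y : P := MvPolynomial.X 0
  let Z : P := MvPolynomial.X 1
  let W : P := MvPolynomial.X 2
  let A := Localization.Away (W - 1)
  have hW1 : W - 1 ≠ 0 := by
    intro h
    have := congrArg (MvPolynomial.eval fun _ => 0) h
    rw [map_sub, MvPolynomial.eval_X, map_one, map_zero] at this
    norm_num at this
  have hle : Submonoid.powers (W - 1) ≤ nonZeroDivisors P :=
    powers_le_nonZeroDivisors_of_noZeroDivisors hW1
  let φ : P →+* A := algebraMap P A
  have hφ : Function.Injective φ := IsLocalization.injective A hle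
  have : IsDomain A := IsLocalization.isDomain_localization hle
  let ι : A →+* FractionRing A := algebraMap A (FractionRing A)
  have hι : Function.Injective ι := IsFractionRing.injective A (FractionRing A)
  let d : A := IsLocalization.Away.invSelf (W - 1)
  have hd : φ (W - 1) * d = 1 := IsLocalization.Away.mul_invSelf (W - 1)
  let X : A := φ (W * (1 + Y * (W - 1))) * d
  have hX : X * φ (W - 1) = φ (W * (1 + Y * (W - 1))) := by
    simp only [X]
    rw [mul_assoc, mul_comm d, hd, mul_one]
  have hrel : φ Y * φ W ^ 2 + (1 - X - φ Y) * φ W + X = 0 := by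
    simp only [map_sub, map_mul, map_add, map_one] at hX
    linear_combination -hX
  have key : (1 + φ W * (φ Z - 1)) * ZASM (m + 1) X (φ Y) (φ Z) =
      (MASM (m + 1) X (φ Y) (φ Z) (φ W)).det := by
    apply hι
    rw [map_mul, map_add, map_mul, map_sub, map_one, map_ZASM, map_det_MASM]
    refine mul_ZASM_field m _ _ _ _ ?_ ?_ ?_
    · have := congrArg ι hrel
      simpa only [map_add, map_mul, map_pow, map_sub, map_one, map_zero] using this
    · intro h
      exact MvPolynomial.X_ne_zero (R := ℤ) (1 : Fin 3) (hφ (hι (by simpa using h)))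
    · intro h
      have h1 : Z = 1 := hφ (hι (by simpa using h))
      have := congrArg (MvPolynomial.eval fun _ => 0) h1
      rw [MvPolynomial.eval_X, map_one] at this
      exact zero_ne_one this
  let g : P →+* R := MvPolynomial.eval₂Hom (Int.castRingHom R) ![y, z, w]
  have hgY : g Y = y := MvPolynomial.eval₂_X _ _ _
  have hgZ : g Z = z := MvPolynomial.eval₂_X _ _ _
  have hgW : g W = w := MvPolynomial.eval₂_X _ _ _
  -- The quadratic takes the value 1 at ω = 1, so its vanishing makes ω - 1 a divisor of 1 in any
  -- ring.
  have hunit : IsUnit (g (W - 1)) := by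
    rw [map_sub, map_one, hgW]
    refine IsUnit.of_mul_eq_one (x - 1 - y - y * (w - 1)) ?_
    linear_combination -hw
  let f : A →+* R := IsLocalization.Away.lift (W - 1) hunit
  have hf : ∀ p, f (φ p) = g p := fun p => IsLocalization.Away.lift_eq (W - 1) hunit p
  have hfX : f X = x := by
    have h := congrArg f hX
    rw [map_mul, hf, hf] at h
    refine hunit.mul_right_cancel (h.trans ?_)
    simp only [map_mul, map_add, map_sub, map_one, hgY, hgW]
    linear_combination hw
  have h := congrArg f key
  rw [map_mul, map_add, map_mul, map_sub, map_one, map_ZASM, map_det_MASM, hfX, hf, hf, hf, hgY,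
    hgZ, hgW] at h
  exact h

end Transfer

end RefinedASM

theorem mainTheorem2 {R : Type*} [CommRing R] (n : ℕ) [NeZero n] (x y z ω : R)
    (hω : y * ω ^ 2 + (1 - x - y) * ω + x = 0) :
    (1 + ω * (z - 1)) * RefinedASM.ZASM n x y z = (RefinedASM.MASM n x y z ω).det := by
  obtain ⟨m, rfl⟩ := Nat.exists_eq_succ_of_ne_zero (NeZero.ne n)
  exact RefinedASM.mul_ZASM m x y z ω hω
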